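/- For a function $\gamma:\mathbb{R}\times\mathbb{R}\to\mathbb{R}$ and a locally integrable $f:\mathbb{R}\to\mathbb{C}$ let $$M_\gamma f(x)=\sup_{r>0}\frac1{2r}\left|\int_{-r}^{r}f(x-t)\,e^{i\gamma(x,t)}\,dt\right| .$$ Let $\gamma$ be of one of the following forms: 1. $\gamma(x,t)=\sum_{j=1}^m c_j(x)|t|^{d_j}$ with $m\ge 1$, real exponents $2\le d_1<\dots<d_m$, $d_m>2$, $c_j\in L^\infty(\mathbb{R})$ for all $j$, and $1/c_m\in L^\infty(\mathbb{R})$; 2. $\gamma(x,t)=a(x)t^2$ with $a,1/a\in L^\infty(\mathbb{R})$; 3. $\gamma(x,t)=t^k$ with an integer $k\ge 2$. Let $\varphi:\mathbb{R}\to(0,\infty)$ be a measurable weight which is radial, i.e. $\varphi(-x)=\varphi(x)$, is non-decreasing on some half-line $[R_0,\infty)$, and satisfies $\varphi(t)\ge c\,(1+|t|)$ for all $t$ with some $c>0$, $\varphi(2x)\le D\,\varphi(x)$ for all $x$ with some $D$, and $\int_{|x|>R}\frac{dx}{\varphi(x)}<\infty$ for some $R>0$. Call such a weight admissible. Let $1\le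 p<\infty$. Then there is a constant $C<\infty$ depending only on $p$, $\gamma$ and $\varphi$ such that, for every weakly differentiable $f$ with $\varphi f\in L^1(\mathbb{R})$ and weak derivative $f'\in L^p(\mathbb{R})$, the function $M_\gamma f$ is Lebesgue measurable and $$\|M_\gamma f\|_1\le C\left(\|\varphi f\|_1+\|f'\|_p\right).$$ In particular, for every real $m>1$ the weight $\psi_m(x)=1+|x|(\log|x|)^m\chi_{\{|x|\ge1\}}(x)$ is admissible. -/

import Mathlib

open MeasureTheory
open scoped ENNReal NNReal ContDiff

/-- The oscillatory maximal function
`M_γ f (x) = sup_{r > 0} (2 r)⁻¹ |∫_{-r}^{r} f (x - t) exp (i γ (x, t)) dt|`, with values in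
`[0, ∞]`. -/
noncomputable def oscMaximal (γ : ℝ → ℝ → ℝ) (f : ℝ → ℂ) (x : ℝ) : ℝ≥0∞ :=
  ⨆ r : ℝ, ⨆ _ : 0 < r,
    ENNReal.ofReal (1 / (2 * r)) *
      ‖∫ t in (-r)..r, f (x - t) * Complex.exp (Complex.I * (γ x t : ℂ))‖ₑ

/-- `c` and `1 / c` both belong to `L^∞(ℝ)`; in particular `c` vanishes only on a null set, since
otherwise `1 / c` is not defined almost everywhere. -/
structure BddWithInv (c : ℝ → ℝ) : Prop where
  memLp : MemLp c ⊤ volume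
  ne_zero : ∀ᵐ x, c x ≠ 0
  memLp_inv : MemLp (fun x => 1 / c x) ⊤ volume

/-- `γ (x, t) = ∑_{j = 1}^{m} c_j (x) |t| ^ d_j` with real exponents `2 ≤ d_1 < ⋯ < d_m`,
`d_m > 2`, all `c_j` in `L^∞` and `1 / c_m` in `L^∞`. The index set `Fin (n + 1)`, with `m = n + 1`,
starts at `0` and ends at `Fin.last n`. -/
def IsSumPhase (γ : ℝ → ℝ → ℝ) : Prop :=
  ∃ (n : ℕ) (c : Fin (n + 1) → ℝ → ℝ) (d : Fin (n + 1) → ℝ),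
    StrictMono d ∧ 2 ≤ d 0 ∧ 2 < d (Fin.last n) ∧
    (∀ j, MemLp (c j) ⊤ volume) ∧ BddWithInv (c (Fin.last n)) ∧
    ∀ x t, γ x t = ∑ j, c j x * |t| ^ d j

/-- `γ (x, t) = a (x) t ^ 2` with `a` and `1 / a` in `L^∞`. -/
def IsQuadraticPhase (γ : ℝ → ℝ → ℝ) : Prop :=
  ∃ a : ℝ → ℝ, BddWithInv a ∧ ∀ x t, γ x t = a x * t ^ 2

/-- `γ (x, t) = t ^ k` for an integer `k ≥ 2`. -/
def IsMonomialPhase (γ : ℝ → ℝ → ℝ) : Prop :=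
  ∃ k : ℕ, 2 ≤ k ∧ ∀ x t, γ x t = t ^ k

/-- `g` is the weak derivative of `f` on the real line. -/
structure IsWeakDeriv (f g : ℝ → ℂ) : Prop where
  locallyIntegrable : LocallyIntegrable f volume
  locallyIntegrable_deriv : LocallyIntegrable g volume
  integral_eq : ∀ ψ : ℝ → ℝ, ContDiff ℝ ∞ ψ → HasCompactSupport ψ →
    ∫ x, ((deriv ψ x : ℝ) : ℂ) * f x = -∫ x, ((ψ x : ℝ) : ℂ) * g x

/-- `f` belongs to `C_p^φ`, with weak derivative `f'`: `φ f ∈ L^1` and `f' ∈ L^p`. -/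
structure MemWeightedSpace (p : ℝ≥0∞) (φ : ℝ → ℝ) (f f' : ℝ → ℂ) : Prop where
  memLp : MemLp (fun x => (φ x : ℂ) * f x) 1 volume
  isWeakDeriv : IsWeakDeriv f f'
  memLp_deriv : MemLp f' p volume

/-- The norm `‖φ f‖_1 + ‖f'‖_p` of `C_p^φ`, where `f'` is the weak derivative of `f`. -/
noncomputable def weightedNorm (p : ℝ≥0∞) (φ : ℝ → ℝ) (f f' : ℝ → ℂ) : ℝ≥0∞ :=
  eLpNorm (fun x => (φ x : ℂ) * f x) 1 volume + eLpNorm f' p volume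

/-- The conditions on the weight: `φ` is radial (even), `φ (t) ≳ 1 + |t|`, `φ` is eventually
non-decreasing, doubling, and `1 / φ` is integrable at infinity. -/
structure IsAdmissibleWeight (φ : ℝ → ℝ) : Prop where
  aemeasurable : AEMeasurable φ volume
  radial : ∀ x, φ (-x) = φ x
  lower_bound : ∃ c : ℝ, 0 < c ∧ ∀ t, c * (1 + |t|) ≤ φ t
  eventually_mono : ∃ R : ℝ, MonotoneOn φ (Set.Ici R)
  doubling : ∃ D : ℝ, ∀ x, φ (2 * x) ≤ D * φ x
  integrable_inv : ∃ R : ℝ, 0 < R ∧ IntegrableOn (fun x => 1 / φ x) {x | R < |x|} volume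

/-- The weight `ψ_m (x) = 1 + |x| (log |x|) ^ m` for `|x| ≥ 1`, and `ψ_m (x) = 1` for `|x| < 1`. -/
noncomputable def logWeight (m : ℝ) (x : ℝ) : ℝ :=
  1 + Set.indicator {y : ℝ | 1 ≤ |y|} (fun y => |y| * (Real.log |y|) ^ m) x

/-!
Every average `(2 r)⁻¹ ∫_{-r}^{r} f (x - t) exp (i γ (x, t)) dt` is estimated pointwise in `x`, for
the absolutely continuous representative `F` of `f`, whose derivative is `g = f'`
(`IsWeakDeriv.exists_primitive`). For bounded `x` it is at most `sup |F| ≤ ‖f‖₁ + ‖f'‖_p`. For large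
`x` the radius is compared with `1` and with `δ (x) = 1 / φ x`.

* For `r ≤ δ (x)` the average is at most the supremum of `|F|` on the ball `B (x, δ (x))`, hence at
  most `φ x ∫_{B (x, δ)} |F| + ∫_{B (x, δ)} |g|`. Doubling and monotonicity of `φ` allow the weight
  to be moved to the integration variable, and Fubini's theorem
  (`lintegral_lintegral_indicator_ball`) bounds the integral over `x` by a multiple of
  `‖φ f‖₁ + ∫ |g| / φ`. Since `1 / φ ≤ 1` outside a bounded set and `1 / φ` is integrable there, Hölder's
  inequality (`lintegral_enorm_mul_le_eLpNorm_mul`) bounds the last integral by a multiple of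
  `‖f'‖_p`. For `δ (x) ≤ r ≤ 1` the first of the two terms suffices.
* For `r ≥ 1`, the part of the integral where `|x - t| ≥ |x| / 2` is at most
  `∫_{|y| ≥ |x| / 2} |F| ≲ ‖φ f‖₁ / φ x`, which is integrable in `x`. The remaining part lives on a
  window `t ∈ x [1 / 2, 3 / 2]` and occurs only if `r ≥ |x| / 2`; it is the only place where
  oscillation matters. As the phase has `|∂_t γ| ≳ |t|` there, its oscillatory integrals are
  `O (1 / |x|)` (`HasOscDecay`), and integration by parts against `F`
  (`enorm_integral_primitive_mul_le`) gives
  `|x|⁻² (sup |F| + ∫_{|y| ≤ |x| / 2} |g|) ≲ |x| ^ (-1 - 1 / p) (‖f‖₁ + ‖f'‖_p)`, which is integrable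
  at infinity because `p < ∞`.

The pointwise bound is `oscMaximal_le_of_large`, and its integral is `lintegral_oscMaximal_le`. All
three kinds of phase agree with a generalised polynomial `∑ c_j (x) |t| ^ d_j` when `t` has the sign
of `x`, which is all that the decay of the oscillatory integrals requires.
-/

/-! ### Primitives of locally integrable functions -/

/-- Integration by parts for two primitives, obtained from Fubini's theorem on the triangle
`a < s ≤ y ≤ b`; neither function has to be continuous. -/
theorem integral_primitive_mul {a b : ℝ} (hab : a ≤ b) {g h : ℝ → ℂ}
    (hg : IntegrableOn g (Set.Ioc a b)) (hh : IntegrableOn h (Set.Ioc a b)) :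
    ∫ y in a..b, (∫ s in a..y, g s) * h y = ∫ s in a..b, g s * ∫ y in s..b, h y := by
  rw [intervalIntegral.integral_of_le hab, intervalIntegral.integral_of_le hab]
  set μ := volume.restrict (Set.Ioc a b) with hμ
  have hT : MeasurableSet {z : ℝ × ℝ | z.2 ≤ z.1} := measurableSet_le measurable_snd measurable_fst
  have hint : Integrable (Function.uncurry fun y s : ℝ =>
      {z : ℝ × ℝ | z.2 ≤ z.1}.indicator (fun z => g z.2 * h z.1) (y, s)) (μ.prod μ) := by
    have : Integrable (fun z : ℝ × ℝ => g z.2 * h z.1) (μ.prod μ) := by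
      simpa [mul_comm] using Integrable.mul_prod (μ := μ) (ν := μ) hh hg
    exact this.indicator hT
  have key := integral_integral_swap hint
  have h1 : ∀ y ∈ Set.Ioc a b, ∫ s, {z : ℝ × ℝ | z.2 ≤ z.1}.indicator
      (fun z => g z.2 * h z.1) (y, s) ∂μ = (∫ s in a..y, g s) * h y := by
    intro y hy
    rw [intervalIntegral.integral_of_le hy.1.le, ← integral_mul_const]
    have : (fun s => {z : ℝ × ℝ | z.2 ≤ z.1}.indicator (fun z => g z.2 * h z.1) (y, s))
        = (Set.Iic y).indicator (fun s => g s * h y) := by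
      ext s; simp [Set.indicator]
    rw [this, integral_indicator measurableSet_Iic, hμ, Measure.restrict_restrict measurableSet_Iic]
    congr 2
    ext s
    simp only [Set.mem_inter_iff, Set.mem_Iic, Set.mem_Ioc]
    constructor
    · rintro ⟨h1, h2, h3⟩; exact ⟨h2, h1⟩
    · rintro ⟨h1, h2⟩; exact ⟨h2, h1, h2.trans hy.2⟩
  have h2 : ∀ s ∈ Set.Ioc a b, ∫ y, {z : ℝ × ℝ | z.2 ≤ z.1}.indicator
      (fun z => g z.2 * h z.1) (y, s) ∂μ = g s * ∫ y in s..b, h y := by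
    intro s hs
    rw [intervalIntegral.integral_of_le hs.2, ← integral_const_mul,
      ← integral_Icc_eq_integral_Ioc (x := s) (y := b)]
    have : (fun y => {z : ℝ × ℝ | z.2 ≤ z.1}.indicator (fun z => g z.2 * h z.1) (y, s))
        = (Set.Ici s).indicator (fun y => g s * h y) := by
      ext s; simp [Set.indicator]
    rw [this, integral_indicator measurableSet_Ici, hμ, Measure.restrict_restrict measurableSet_Ici]
    congr 2
    ext y
    simp only [Set.mem_inter_iff, Set.mem_Ici, Set.mem_Ioc, Set.mem_Icc]
    constructor
    · rintro ⟨h1, h2, h3⟩; exact ⟨h1, h3⟩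
    · rintro ⟨h1, h2⟩; exact ⟨h1, hs.1.trans_le h1, h2⟩
  rw [← setIntegral_congr_fun measurableSet_Ioc h1, ← setIntegral_congr_fun measurableSet_Ioc h2]
  exact key

/-- A test function of mean zero is the derivative of its primitive from `-∞`, which vanishes to the
left of the support trivially and to the right of it because the mean is zero. -/
theorem exists_hasCompactSupport_hasDerivAt {ψ : ℝ → ℝ} (hψ : Continuous ψ)
    (hc : HasCompactSupport ψ) (h0 : ∫ x, ψ x = 0) :
    ∃ Ψ : ℝ → ℝ, HasCompactSupport Ψ ∧ ∀ x, HasDerivAt Ψ (ψ x) x := by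
  obtain ⟨A, hA⟩ := hc.isCompact.isBounded.subset_closedBall 0
  have hz : ∀ x, A < |x| → ψ x = 0 := fun x hx => by
    by_contra hne
    have := hA (subset_tsupport ψ hne)
    simp only [Metric.mem_closedBall, dist_zero_right, Real.norm_eq_abs] at this
    linarith
  have hii : ∀ a b, IntervalIntegrable ψ volume a b := fun a b => hψ.intervalIntegrable a b
  have hi : Integrable ψ := hψ.integrable_of_hasCompactSupport hc
  refine ⟨fun x => ∫ t in Set.Iic x, ψ t, ?_, fun x => ?_⟩
  · refine HasCompactSupport.of_support_subset_isCompact (isCompact_closedBall (0 : ℝ) A) ?_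
    intro x hx
    by_contra hxA
    simp only [Metric.mem_closedBall, dist_zero_right, Real.norm_eq_abs, not_le] at hxA
    apply hx
    rcases le_total 0 x with h | h
    · have h2 : ∫ t in Set.Ioi x, ψ t = 0 := by
        refine setIntegral_eq_zero_of_forall_eq_zero fun t ht => hz t ?_
        rw [abs_of_nonneg h] at hxA
        exact hxA.trans ((Set.mem_Ioi.1 ht).trans_le (le_abs_self t))
      have := intervalIntegral.integral_Iic_add_Ioi (b := x) hi.integrableOn hi.integrableOn
      simp only
      rw [h2, h0, add_zero] at this
      exact this
    · refine setIntegral_eq_zero_of_forall_eq_zero fun t ht => hz t ?_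
      rw [abs_of_nonpos h] at hxA
      have := Set.mem_Iic.1 ht
      have := neg_le_abs t
      linarith
  · have : (fun x => ∫ t in Set.Iic x, ψ t)
        = fun x => (∫ t in Set.Iic (0 : ℝ), ψ t) + ∫ t in (0 : ℝ)..x, ψ t := by
      ext y
      rw [← intervalIntegral.integral_Iic_sub_Iic hi.integrableOn hi.integrableOn]
      ring
    rw [this]
    exact (intervalIntegral.integral_hasDerivAt_right (hii _ _)
      (hψ.stronglyMeasurableAtFilter _ _) hψ.continuousAt).const_add _

theorem integral_deriv_mul_primitive {g F : ℝ → ℂ} (hg : LocallyIntegrable g)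
    (hF : ∀ a b, F b - F a = ∫ t in a..b, g t) {ψ : ℝ → ℝ} (hψ : ContDiff ℝ ∞ ψ)
    (hc : HasCompactSupport ψ) :
    ∫ x, ((deriv ψ x : ℝ) : ℂ) * F x = -∫ x, ((ψ x : ℝ) : ℂ) * g x := by
  obtain ⟨A, hA0, hA⟩ : ∃ A : ℝ, 0 < A ∧ tsupport ψ ⊆ Set.Ioo (-A) A := by
    obtain ⟨A, hA⟩ := hc.isCompact.isBounded.subset_ball_lt 0 0
    refine ⟨A, hA.1, hA.2.trans ?_⟩
    rw [Real.ball_eq_Ioo]; simp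
  have hle : -A ≤ A := by linarith
  have hd : Continuous (deriv ψ) := hψ.continuous_deriv (by simp)
  have hsub : Set.Ioo (-A) A ⊆ Set.Ioc (-A) A := Set.Ioo_subset_Ioc_self
  have e1 : ∫ x, ((deriv ψ x : ℝ) : ℂ) * F x = ∫ x in (-A)..A, ((deriv ψ x : ℝ) : ℂ) * F x := by
    symm
    refine intervalIntegral.integral_eq_integral_of_support_subset ?_
    refine Set.Subset.trans ?_ ((support_deriv_subset.trans hA).trans hsub)
    intro x hx h0; simp [h0] at hx
  have e2 : ∫ x, ((ψ x : ℝ) : ℂ) * g x = ∫ x in (-A)..A, ((ψ x : ℝ) : ℂ) * g x := by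
    symm
    refine intervalIntegral.integral_eq_integral_of_support_subset ?_
    refine Set.Subset.trans ?_ ((subset_tsupport ψ).trans (hA.trans hsub))
    intro x hx h0; simp [h0] at hx
  have hψA : ψ A = 0 := by
    by_contra h
    exact absurd (hA (subset_tsupport ψ h)).2 (lt_irrefl _)
  have hψA' : ψ (-A) = 0 := by
    by_contra h
    exact absurd (hA (subset_tsupport ψ h)).1 (lt_irrefl _)
  have hFTC : ∀ s u : ℝ, ∫ y in s..u, ((deriv ψ y : ℝ) : ℂ) = ((ψ u - ψ s : ℝ) : ℂ) := by
    intro s u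
    rw [intervalIntegral.integral_ofReal, intervalIntegral.integral_deriv_eq_sub
      (fun x _ => (hψ.differentiable (by simp)).differentiableAt) (hd.intervalIntegrable _ _)]
  have hgi : IntegrableOn g (Set.Ioc (-A) A) :=
    (hg.integrableOn_isCompact isCompact_Icc).mono_set Set.Ioc_subset_Icc_self
  have hdc : Continuous fun y => ((deriv ψ y : ℝ) : ℂ) := Complex.continuous_ofReal.comp hd
  have hdi : IntegrableOn (fun y => ((deriv ψ y : ℝ) : ℂ)) (Set.Ioc (-A) A) :=
    (hdc.integrableOn_Icc).mono_set Set.Ioc_subset_Icc_self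
  have key := integral_primitive_mul hle hgi hdi
  rw [e1, e2]
  have hGc : ContinuousOn (fun y => ∫ s in (-A)..y, g s) (Set.uIcc (-A) A) :=
    intervalIntegral.continuousOn_primitive_interval
      (by rw [Set.uIcc_of_le hle]; exact hg.integrableOn_isCompact isCompact_Icc)
  calc ∫ x in (-A)..A, ((deriv ψ x : ℝ) : ℂ) * F x
      = ∫ x in (-A)..A, (F (-A) * ((deriv ψ x : ℝ) : ℂ)
          + (∫ s in (-A)..x, g s) * ((deriv ψ x : ℝ) : ℂ)) := by
        refine intervalIntegral.integral_congr fun x _ => ?_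
        simp only [← hF]; ring
    _ = F (-A) * (∫ x in (-A)..A, ((deriv ψ x : ℝ) : ℂ))
          + ∫ x in (-A)..A, (∫ s in (-A)..x, g s) * ((deriv ψ x : ℝ) : ℂ) := by
        rw [intervalIntegral.integral_add, intervalIntegral.integral_const_mul]
        · exact (hdc.intervalIntegrable _ _).const_mul _
        · exact (hGc.mul hdc.continuousOn).intervalIntegrable
    _ = -∫ x in (-A)..A, ((ψ x : ℝ) : ℂ) * g x := by
        rw [key, hFTC, hψA, hψA', ← intervalIntegral.integral_neg]
        simp only [hFTC, hψA, sub_zero, Complex.ofReal_zero, mul_zero, zero_add]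
        refine intervalIntegral.integral_congr fun x _ => ?_
        simp only [zero_sub, Complex.ofReal_neg]; ring

theorem continuous_of_primitive {g F : ℝ → ℂ} (hg : LocallyIntegrable g)
    (hF : ∀ a b, F b - F a = ∫ t in a..b, g t) : Continuous F := by
  have : F = fun x => F 0 + ∫ t in (0 : ℝ)..x, g t := by
    ext x; rw [← hF]; ring
  rw [this]
  exact continuous_const.add (intervalIntegral.continuous_primitive
    (fun a b => (hg.integrableOn_isCompact isCompact_uIcc).intervalIntegrable) 0)

/-- The du Bois-Reymond lemma: testing against the compactly supported function
`ψ - (∫ ψ) ψ₀`, whose integral vanishes, reduces the claim to the fundamental lemma of the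
calculus of variations. -/
theorem ae_eq_const_of_integral_deriv_mul_eq_zero {u : ℝ → ℂ} (hu : LocallyIntegrable u)
    (h : ∀ ψ : ℝ → ℝ, ContDiff ℝ ∞ ψ → HasCompactSupport ψ →
      ∫ x, ((deriv ψ x : ℝ) : ℂ) * u x = 0) :
    ∃ c : ℂ, u =ᵐ[volume] fun _ => c := by
  let B : ContDiffBump (0 : ℝ) := ⟨1, 2, one_pos, one_lt_two⟩
  set ψ₀ : ℝ → ℝ := B.normed volume with hψ₀
  have h0c : ContDiff ℝ ∞ ψ₀ := B.contDiff_normed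
  have h0s : HasCompactSupport ψ₀ := B.hasCompactSupport_normed
  have h0i : ∫ x, ψ₀ x = 1 := B.integral_normed
  set c : ℂ := ∫ x, ((ψ₀ x : ℝ) : ℂ) * u x with hc
  refine ⟨c, ?_⟩
  have hmul : ∀ ψ : ℝ → ℝ, Continuous ψ → HasCompactSupport ψ →
      Integrable fun x => ((ψ x : ℝ) : ℂ) * u x := by
    intro ψ hψ hs
    have := hu.integrable_smul_left_of_hasCompactSupport hψ hs
    simpa using this
  have key : ∀ᵐ x, u x - c = 0 := by
    refine ae_eq_zero_of_integral_contDiff_smul_eq_zero (hu.sub (locallyIntegrable_const c)) ?_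
    intro ψ hψ hs
    set a : ℝ := ∫ x, ψ x with ha
    have hi : Integrable ψ := hψ.continuous.integrable_of_hasCompactSupport hs
    have hi0 : Integrable ψ₀ := h0c.continuous.integrable_of_hasCompactSupport h0s
    have hcd : ContDiff ℝ ∞ fun x => ψ x - a * ψ₀ x := hψ.sub (contDiff_const.mul h0c)
    obtain ⟨Ψ, hΨs, hΨ⟩ := exists_hasCompactSupport_hasDerivAt (ψ := fun x => ψ x - a * ψ₀ x)
      hcd.continuous (hs.sub (h0s.mul_left (f := fun _ => a)))
      (by rw [integral_sub hi (hi0.const_mul a), integral_const_mul, h0i]; simp [ha])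
    have hdΨ : deriv Ψ = fun x => ψ x - a * ψ₀ x := funext fun x => (hΨ x).deriv
    have hΨc : ContDiff ℝ ∞ Ψ := by
      rw [contDiff_infty_iff_deriv]
      exact ⟨fun x => (hΨ x).differentiableAt, hdΨ ▸ hcd⟩
    have := h Ψ hΨc hΨs
    rw [hdΨ] at this
    have e : ∫ x, (((ψ x - a * ψ₀ x : ℝ)) : ℂ) * u x
        = (∫ x, ((ψ x : ℝ) : ℂ) * u x) - a * c := by
      rw [hc, ← integral_const_mul, ← integral_sub (hmul ψ hψ.continuous hs)
        ((hmul ψ₀ h0c.continuous h0s).const_mul _)]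
      congr 1; ext x; push_cast; ring
    rw [e] at this
    have e2 : ∫ x, ψ x • (u x - c) = (∫ x, ((ψ x : ℝ) : ℂ) * u x) - a * c := by
      have hi' : Integrable fun x => ((ψ x : ℝ) : ℂ) := hi.ofReal
      have : ((a : ℝ) : ℂ) = ∫ x, ((ψ x : ℝ) : ℂ) := by rw [ha]; exact integral_ofReal.symm
      rw [this, ← integral_mul_const, ← integral_sub (hmul ψ hψ.continuous hs) (hi'.mul_const _)]
      congr 1; ext x; simp [mul_sub]
    exact e2.trans this
  filter_upwards [key] with x hx
  exact sub_eq_zero.1 hx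

/-- A function with a locally integrable weak derivative has an absolutely continuous
representative. -/
theorem IsWeakDeriv.exists_primitive {f g : ℝ → ℂ} (h : IsWeakDeriv f g) :
    ∃ F : ℝ → ℂ, f =ᵐ[volume] F ∧ ∀ a b, F b - F a = ∫ t in a..b, g t := by
  have hg := h.locallyIntegrable_deriv
  have hgi : ∀ a b, IntervalIntegrable g volume a b := fun a b =>
    (hg.integrableOn_isCompact isCompact_uIcc).intervalIntegrable
  set G : ℝ → ℂ := fun x => ∫ t in (0 : ℝ)..x, g t with hG
  have hGp : ∀ a b, G b - G a = ∫ t in a..b, g t := fun a b =>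
    intervalIntegral.integral_interval_sub_left (hgi _ _) (hgi _ _)
  have hGc : Continuous G := continuous_of_primitive hg hGp
  have hGl : LocallyIntegrable G := hGc.locallyIntegrable
  obtain ⟨c, hc⟩ := ae_eq_const_of_integral_deriv_mul_eq_zero
    (h.locallyIntegrable.sub hGl) (fun ψ hψ hs => by
      have hd : Continuous (deriv ψ) := hψ.continuous_deriv (by simp)
      have i1 : Integrable fun x => ((deriv ψ x : ℝ) : ℂ) * f x := by
        simpa using h.locallyIntegrable.integrable_smul_left_of_hasCompactSupport hd hs.deriv
      have i2 : Integrable fun x => ((deriv ψ x : ℝ) : ℂ) * G x := by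
        simpa using hGl.integrable_smul_left_of_hasCompactSupport hd hs.deriv
      simp only [Pi.sub_apply, mul_sub]
      rw [integral_sub i1 i2, h.integral_eq ψ hψ hs, integral_deriv_mul_primitive hg hGp hψ hs,
        sub_self])
  refine ⟨fun x => G x + c, ?_, fun a b => by rw [← hGp]; ring⟩
  filter_upwards [hc] with x hx
  rw [← hx]; simp

/-! ### The oscillatory maximal function: invariance and measurability -/

theorem oscMaximal_congr_ae (γ : ℝ → ℝ → ℝ) {f F : ℝ → ℂ} (h : f =ᵐ[volume] F) (x : ℝ) :
    oscMaximal γ f x = oscMaximal γ F x := by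
  have hx : ∀ᵐ t, f (x - t) = F (x - t) :=
    (Measure.measurePreserving_sub_left volume x).quasiMeasurePreserving.ae h
  have : ∀ r : ℝ, ∫ t in (-r)..r, f (x - t) * Complex.exp (Complex.I * (γ x t : ℂ))
      = ∫ t in (-r)..r, F (x - t) * Complex.exp (Complex.I * (γ x t : ℂ)) := fun r => by
    refine intervalIntegral.integral_congr_ae ?_
    filter_upwards [hx] with t ht _
    rw [ht]
  simp only [oscMaximal, this]

/-- The averages depend continuously on `r`, so the supremum may be taken over rational `r`. -/
theorem aemeasurable_oscMaximal {γ : ℝ → ℝ → ℝ} {F : ℝ → ℂ} (hF : Continuous F)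
    (hγc : ∀ x, Continuous (γ x))
    (hγ : AEMeasurable (Function.uncurry γ) (volume.prod volume)) :
    AEMeasurable (oscMaximal γ F) volume := by
  set J : ℝ → ℝ → ℝ≥0∞ := fun r x => ENNReal.ofReal (1 / (2 * r)) *
      ‖∫ t in (-r)..r, F (x - t) * Complex.exp (Complex.I * (γ x t : ℂ))‖ₑ with hJ
  have hmeas : ∀ r, 0 < r → AEMeasurable (J r) volume := by
    intro r hr
    have h1 : AEStronglyMeasurable (fun z : ℝ × ℝ =>
        F (z.1 - z.2) * Complex.exp (Complex.I * (γ z.1 z.2 : ℂ))) (volume.prod volume) := by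
      have hc : Measurable fun s : ℝ => Complex.exp (Complex.I * (s : ℂ)) := by fun_prop
      have h2 : AEMeasurable (fun z : ℝ × ℝ => Complex.exp (Complex.I * (γ z.1 z.2 : ℂ)))
          (volume.prod volume) := hc.comp_aemeasurable hγ
      have h3 : Continuous fun z : ℝ × ℝ => F (z.1 - z.2) := by fun_prop
      exact h3.aestronglyMeasurable.mul h2.aestronglyMeasurable
    have h4 : AEStronglyMeasurable (fun z : ℝ × ℝ =>
        F (z.1 - z.2) * Complex.exp (Complex.I * (γ z.1 z.2 : ℂ)))
        (volume.prod (volume.restrict (Set.Ioc (-r) r))) :=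
      h1.mono_ac (Measure.AbsolutelyContinuous.rfl.prod
        Measure.restrict_le_self.absolutelyContinuous)
    have h5 := h4.integral_prod_right'
    have h6 : (fun x => ∫ t in (-r)..r, F (x - t) * Complex.exp (Complex.I * (γ x t : ℂ)))
        = fun x => ∫ t in Set.Ioc (-r) r, F (x - t) * Complex.exp (Complex.I * (γ x t : ℂ)) := by
      ext x; exact intervalIntegral.integral_of_le (by linarith)
    have h7 : AEStronglyMeasurable (fun x => ∫ t in (-r)..r,
        F (x - t) * Complex.exp (Complex.I * (γ x t : ℂ))) volume := by
      rw [h6]; exact h5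
    exact h7.enorm.const_mul _
  have hcont : ∀ x, ContinuousOn (fun r => J r x) (Set.Ioi 0) := by
    intro x
    have hγx := hγc x
    have hk : Continuous fun t => F (x - t) * Complex.exp (Complex.I * (γ x t : ℂ)) := by fun_prop
    have hI : Continuous fun r => ∫ t in (-r)..r,
        F (x - t) * Complex.exp (Complex.I * (γ x t : ℂ)) := by
      have hp := intervalIntegral.continuous_primitive (μ := volume)
        (fun a b => hk.intervalIntegrable a b) 0
      have : (fun r => ∫ t in (-r)..r, F (x - t) * Complex.exp (Complex.I * (γ x t : ℂ)))
          = fun r => (∫ t in (0 : ℝ)..r, F (x - t) * Complex.exp (Complex.I * (γ x t : ℂ)))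
            - ∫ t in (0 : ℝ)..(-r), F (x - t) * Complex.exp (Complex.I * (γ x t : ℂ)) := by
        ext r
        exact (intervalIntegral.integral_interval_sub_left
          (hk.intervalIntegrable _ _) (hk.intervalIntegrable _ _)).symm
      rw [this]
      exact hp.sub (hp.comp continuous_neg)
    have he : (fun r => J r x) = fun r => ENNReal.ofReal (1 / (2 * r) *
        ‖∫ t in (-r)..r, F (x - t) * Complex.exp (Complex.I * (γ x t : ℂ))‖) := by
      ext r
      rw [ENNReal.ofReal_mul' (norm_nonneg _), ofReal_norm]
    rw [he]
    refine ENNReal.continuous_ofReal.comp_continuousOn (ContinuousOn.mul ?_ hI.norm.continuousOn)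
    refine ContinuousOn.div continuousOn_const (by fun_prop) fun r hr => ?_
    have : (0 : ℝ) < r := hr
    positivity
  have hsup : oscMaximal γ F = fun x => ⨆ q : {q : ℚ // 0 < q}, J (q : ℚ) x := by
    ext x
    refine le_antisymm (iSup₂_le fun r hr => le_of_forall_lt fun a ha => ?_)
      (iSup_le fun q => le_iSup₂_of_le (q : ℝ) (by exact_mod_cast q.2) le_rfl)
    have hopen : IsOpen (Set.Ioi (0 : ℝ) ∩ (fun r => J r x) ⁻¹' Set.Ioi a) :=
      (hcont x).isOpen_inter_preimage isOpen_Ioi isOpen_Ioi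
    obtain ⟨q, hq⟩ := Rat.denseRange_cast.exists_mem_open hopen ⟨r, hr, ha⟩
    exact lt_of_lt_of_le hq.2
      (le_iSup (fun q : {q : ℚ // 0 < q} => J (q : ℚ) x) ⟨q, Rat.cast_pos.1 (Set.mem_Ioi.1 hq.1)⟩)
  rw [hsup]
  exact AEMeasurable.iSup fun q => hmeas _ (by exact_mod_cast q.2)

/-! ### Pointwise bounds for the averages -/

theorem enorm_intervalIntegral_le (f : ℝ → ℂ) (a b : ℝ) :
    ‖∫ t in a..b, f t‖ₑ ≤ ∫⁻ t in Set.uIoc a b, ‖f t‖ₑ := by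
  refine le_trans (le_of_eq ?_) (enorm_integral_le_lintegral_enorm _)
  rw [← ofReal_norm, ← ofReal_norm, intervalIntegral.norm_integral_eq_norm_integral_uIoc]

theorem setLIntegral_comp_sub_left_le (G : ℝ → ℝ≥0∞) {s u : Set ℝ} (hs : MeasurableSet s)
    {x : ℝ} (h : ∀ t ∈ s, x - t ∈ u) (hu : MeasurableSet u) :
    ∫⁻ t in s, G (x - t) ≤ ∫⁻ y in u, G y := by
  rw [← lintegral_indicator hs, ← lintegral_indicator hu,
    ← lintegral_sub_left_eq_self (u.indicator G) x]
  refine lintegral_mono fun t => ?_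
  by_cases ht : t ∈ s
  · simp [ht, h t ht]
  · simp [ht]

theorem enorm_le_average_add_of_primitive {g F : ℝ → ℂ}
    (hF : ∀ a b, F b - F a = ∫ t in a..b, g t) {a b x : ℝ} (hab : a < b)
    (hx : x ∈ Set.Icc a b) :
    ‖F x‖ₑ ≤ ENNReal.ofReal (1 / (b - a)) * (∫⁻ y in Set.Icc a b, ‖F y‖ₑ)
      + ∫⁻ y in Set.Icc a b, ‖g y‖ₑ := by
  set I := ∫⁻ y in Set.Icc a b, ‖g y‖ₑ
  have h1 : ∀ y ∈ Set.Icc a b, ‖F x‖ₑ ≤ ‖F y‖ₑ + I := by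
    intro y hy
    have : F x = F y + ∫ t in y..x, g t := by rw [← hF]; ring
    rw [this]
    refine (enorm_add_le _ _).trans (add_le_add_right ((enorm_intervalIntegral_le _ _ _).trans ?_) _)
    exact lintegral_mono_set (Set.uIoc_subset_uIcc.trans (Set.uIcc_subset_Icc hy hx))
  have h2 : ENNReal.ofReal (b - a) * ‖F x‖ₑ
      ≤ (∫⁻ y in Set.Icc a b, ‖F y‖ₑ) + ENNReal.ofReal (b - a) * I := by
    calc ENNReal.ofReal (b - a) * ‖F x‖ₑ = ∫⁻ _ in Set.Icc a b, ‖F x‖ₑ := by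
          rw [setLIntegral_const, Real.volume_Icc, mul_comm]
      _ ≤ ∫⁻ y in Set.Icc a b, (‖F y‖ₑ + I) := setLIntegral_mono' measurableSet_Icc h1
      _ = _ := by
          rw [lintegral_add_right _ measurable_const, setLIntegral_const, Real.volume_Icc, mul_comm I]
  have hpos : 0 < b - a := by linarith
  have h3 : ENNReal.ofReal (1 / (b - a)) * ENNReal.ofReal (b - a) = 1 := by
    rw [← ENNReal.ofReal_mul (by positivity), one_div_mul_cancel hpos.ne', ENNReal.ofReal_one]
  calc ‖F x‖ₑ = ENNReal.ofReal (1 / (b - a)) * (ENNReal.ofReal (b - a) * ‖F x‖ₑ) := by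
        rw [← mul_assoc, h3, one_mul]
    _ ≤ ENNReal.ofReal (1 / (b - a)) *
        ((∫⁻ y in Set.Icc a b, ‖F y‖ₑ) + ENNReal.ofReal (b - a) * I) := by gcongr
    _ = _ := by rw [mul_add, ← mul_assoc _ _ I, h3, one_mul]

theorem enorm_intervalIntegral_mul_le {F e : ℝ → ℂ} (he1 : ∀ t, ‖e t‖ = 1) {a b x : ℝ} {u : Set ℝ}
    (hu : MeasurableSet u) (h : ∀ t ∈ Set.uIoc a b, x - t ∈ u) :
    ‖∫ t in a..b, F (x - t) * e t‖ₑ ≤ ∫⁻ y in u, ‖F y‖ₑ := by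
  refine (enorm_intervalIntegral_le _ _ _).trans ?_
  have : ∀ t, ‖F (x - t) * e t‖ₑ = ‖F (x - t)‖ₑ := fun t => by
    rw [enorm_mul, ← ofReal_norm (e t), he1, ENNReal.ofReal_one, mul_one]
  simp only [this]
  exact setLIntegral_comp_sub_left_le (fun y => ‖F y‖ₑ) measurableSet_uIoc h hu

theorem average_le_of_enorm_le {F e : ℝ → ℂ} (he1 : ∀ t, ‖e t‖ = 1) {x r : ℝ} (hr : 0 < r)
    {B : ℝ≥0∞} (h : ∀ y ∈ Set.Icc (x - r) (x + r), ‖F y‖ₑ ≤ B) :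
    ENNReal.ofReal (1 / (2 * r)) * ‖∫ t in (-r)..r, F (x - t) * e t‖ₑ ≤ B := by
  calc ENNReal.ofReal (1 / (2 * r)) * ‖∫ t in (-r)..r, F (x - t) * e t‖ₑ
      ≤ ENNReal.ofReal (1 / (2 * r)) * ∫⁻ y in Set.Icc (x - r) (x + r), ‖F y‖ₑ := by
        gcongr
        refine enorm_intervalIntegral_mul_le he1 measurableSet_Icc fun t ht => ?_
        rw [Set.uIoc_of_le (by linarith)] at ht
        exact ⟨by linarith [ht.2], by linarith [ht.1]⟩
    _ ≤ ENNReal.ofReal (1 / (2 * r)) * ∫⁻ y in Set.Icc (x - r) (x + r), B := by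
        exact mul_le_mul_right (setLIntegral_mono' measurableSet_Icc h) _
    _ = B := by
        rw [setLIntegral_const, Real.volume_Icc, mul_comm B, ← mul_assoc,
          ← ENNReal.ofReal_mul (by positivity)]
        have : 1 / (2 * r) * (x + r - (x - r)) = 1 := by field_simp; ring
        rw [this, ENNReal.ofReal_one, one_mul]

/-- Integration by parts: the oscillation of `e` is measured only through its integrals over
subintervals, so no regularity of `F` beyond absolute continuity is used. -/
theorem enorm_integral_primitive_mul_le {g F e : ℝ → ℂ} (hg : LocallyIntegrable g)
    (hF : ∀ a b, F b - F a = ∫ t in a..b, g t) (he : Continuous e) {a b x M : ℝ} (hab : a ≤ b)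
    (hM : ∀ s ∈ Set.Icc a b, ‖∫ t in s..b, e t‖ ≤ M) :
    ‖∫ t in a..b, F (x - t) * e t‖ₑ
      ≤ ENNReal.ofReal M * (‖F (x - a)‖ₑ + ∫⁻ y in Set.Icc (x - b) (x - a), ‖g y‖ₑ) := by
  have hgx : LocallyIntegrable fun t => g (x - t) := by
    intro y
    obtain ⟨s, hs, hi⟩ := hg (x - y)
    refine ⟨(fun t => x - t) ⁻¹' s, (continuous_const.sub continuous_id).continuousAt hs, ?_⟩
    exact (((Measure.measurePreserving_sub_left volume x).integrableOn_comp_preimage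
      (Homeomorph.subLeft x).measurableEmbedding).2 hi)
  have hgi : IntegrableOn (fun t => g (x - t)) (Set.Ioc a b) :=
    (hgx.integrableOn_isCompact isCompact_Icc).mono_set Set.Ioc_subset_Icc_self
  have hei : IntegrableOn e (Set.Ioc a b) := he.integrableOn_Icc.mono_set Set.Ioc_subset_Icc_self
  have hGc : ContinuousOn (fun y => ∫ s in a..y, g (x - s)) (Set.uIcc a b) :=
    intervalIntegral.continuousOn_primitive_interval
      (by rw [Set.uIcc_of_le hab]; exact hgx.integrableOn_isCompact isCompact_Icc)
  have hGe : IntervalIntegrable (fun y => (∫ s in a..y, g (x - s)) * e y) volume a b :=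
    (hGc.mul he.continuousOn).intervalIntegrable
  have e1 : ∫ t in a..b, F (x - t) * e t
      = F (x - a) * (∫ t in a..b, e t) - ∫ s in a..b, g (x - s) * ∫ t in s..b, e t := by
    rw [← integral_primitive_mul hab hgi hei, ← intervalIntegral.integral_const_mul,
      ← intervalIntegral.integral_sub ((he.intervalIntegrable _ _).const_mul _) hGe]
    refine intervalIntegral.integral_congr fun t _ => ?_
    simp only [intervalIntegral.integral_comp_sub_left (fun s => g s) x, ← hF]
    ring
  have hM' : ∀ s ∈ Set.Icc a b, ‖∫ t in s..b, e t‖ₑ ≤ ENNReal.ofReal M := fun s hs => by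
    rw [← ofReal_norm]; exact ENNReal.ofReal_le_ofReal (hM s hs)
  rw [e1]
  refine (enorm_sub_le).trans ?_
  rw [mul_add]
  refine add_le_add ?_ ?_
  · rw [enorm_mul, mul_comm]
    gcongr
    exact hM' a ⟨le_rfl, hab⟩
  · refine (enorm_intervalIntegral_le _ _ _).trans ?_
    rw [Set.uIoc_of_le hab]
    calc ∫⁻ s in Set.Ioc a b, ‖g (x - s) * ∫ t in s..b, e t‖ₑ
        ≤ ∫⁻ s in Set.Ioc a b, ENNReal.ofReal M * ‖g (x - s)‖ₑ := by
          refine setLIntegral_mono' measurableSet_Ioc fun s hs => ?_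
          rw [enorm_mul, mul_comm]
          gcongr
          exact hM' s ⟨hs.1.le, hs.2⟩
      _ = ENNReal.ofReal M * ∫⁻ s in Set.Ioc a b, ‖g (x - s)‖ₑ :=
          lintegral_const_mul' _ _ ENNReal.ofReal_ne_top
      _ ≤ _ := by
          refine mul_le_mul_right (setLIntegral_comp_sub_left_le (fun y => ‖g y‖ₑ)
            measurableSet_Ioc (fun t ht => ?_) measurableSet_Icc) _
          exact ⟨by linarith [ht.2], by linarith [ht.1]⟩

/-- The averages over `r ≤ 1 / w` are controlled by the supremum of `F`, those with
`1 / w ≤ r ≤ 1` by the mass of `F`, and for `r ≥ 1` only the window `x / 2 ≤ t ≤ 3 x / 2`, where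
`x - t` may be near the origin, requires the oscillation of `e`. -/
theorem average_le_of_pos {g F e : ℝ → ℂ} (hg : LocallyIntegrable g)
    (hF : ∀ a b, F b - F a = ∫ t in a..b, g t) (he : Continuous e) (he1 : ∀ t, ‖e t‖ = 1)
    {x w K r : ℝ} {S : ℝ≥0∞} (hx : 0 < x) (hw : 1 ≤ w) (hS : ∀ y, ‖F y‖ₑ ≤ S) (hr : 0 < r)
    (hK : ∀ a b, x / 2 ≤ a → a ≤ b → b ≤ 3 * x / 2 → ‖∫ t in a..b, e t‖ ≤ K / x) :
    ENNReal.ofReal (1 / (2 * r)) * ‖∫ t in (-r)..r, F (x - t) * e t‖ₑ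
      ≤ ENNReal.ofReal w * (∫⁻ y in Metric.closedBall x 1, ‖F y‖ₑ)
        + (∫⁻ y in Metric.closedBall x (1 / w), ‖g y‖ₑ)
        + (∫⁻ y in {y : ℝ | |x| / 2 ≤ |y|}, ‖F y‖ₑ)
        + ENNReal.ofReal (K / x ^ 2) * (S + ∫⁻ y in {y : ℝ | |y| ≤ |x| / 2}, ‖g y‖ₑ) := by
  have hw0 : 0 < w := by linarith
  have hFc : Continuous F := continuous_of_primitive hg hF
  rw [abs_of_pos hx]
  rcases le_or_gt r (1 / w) with h1 | h1
  · refine le_trans ?_ (le_trans le_self_add le_self_add)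
    refine average_le_of_enorm_le he1 hr fun y hy => ?_
    have hδ : 0 < 1 / w := by positivity
    have hδ1 : 1 / w ≤ 1 := by rw [div_le_one hw0]; exact hw
    have := enorm_le_average_add_of_primitive hF (a := x - 1 / w) (b := x + 1 / w) (x := y)
      (by linarith) ⟨by linarith [hy.1], by linarith [hy.2]⟩
    rw [← Real.closedBall_eq_Icc] at this
    refine this.trans (add_le_add_left (mul_le_mul' (ENNReal.ofReal_le_ofReal ?_)
      (lintegral_mono_set (Metric.closedBall_subset_closedBall hδ1))) _)
    have : 1 / (x + 1 / w - (x - 1 / w)) = w / 2 := by field_simp; ring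
    rw [this]; linarith
  rcases le_or_gt r 1 with h2 | h2
  · refine le_trans ?_ (le_trans le_self_add (le_trans le_self_add le_self_add))
    refine mul_le_mul' (ENNReal.ofReal_le_ofReal ?_) ?_
    · rw [div_le_iff₀ (by positivity)]
      rw [div_lt_iff₀ hw0] at h1
      nlinarith
    · refine enorm_intervalIntegral_mul_le he1 measurableSet_closedBall fun t ht => ?_
      rw [Set.uIoc_of_le (by linarith)] at ht
      rw [Real.closedBall_eq_Icc]
      exact ⟨by linarith [ht.2], by linarith [ht.1]⟩
  have hms : MeasurableSet {y : ℝ | x / 2 ≤ |y|} :=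
    measurableSet_le measurable_const continuous_abs.measurable
  have hki : ∀ a b, IntervalIntegrable (fun t => F (x - t) * e t) volume a b := fun a b =>
    Continuous.intervalIntegrable (by fun_prop) a b
  set T := ∫⁻ y in {y : ℝ | x / 2 ≤ |y|}, ‖F y‖ₑ with hT
  have hr1 : ENNReal.ofReal (1 / (2 * r)) * (T + T) ≤ T := by
    rw [← two_mul, ← mul_assoc]
    have : ENNReal.ofReal (1 / (2 * r)) * 2 ≤ 1 := by
      rw [show (2 : ℝ≥0∞) = ENNReal.ofReal 2 by simp, ← ENNReal.ofReal_mul (by positivity),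
        ENNReal.ofReal_le_one]
      rw [div_mul_eq_mul_div, div_le_one (by positivity)]; linarith
    calc _ ≤ 1 * T := by gcongr
      _ = T := one_mul T
  rcases le_or_gt r (x / 2) with h3 | h3
  · refine le_trans ?_ (le_trans le_add_self le_self_add)
    refine le_trans ?_ hr1
    gcongr
    refine le_trans ?_ le_self_add
    refine enorm_intervalIntegral_mul_le he1 hms fun t ht => ?_
    rw [Set.uIoc_of_le (by linarith)] at ht
    exact (show x / 2 ≤ x - t by linarith [ht.2]).trans (le_abs_self _)
  refine le_trans ?_ (add_le_add_left le_add_self _)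
  set b := min r (3 * x / 2) with hb
  have hbr : b ≤ r := min_le_left _ _
  have hbx : b ≤ 3 * x / 2 := min_le_right _ _
  have hab : x / 2 ≤ b := le_min h3.le (by linarith)
  have hsplit : ∫ t in (-r)..r, F (x - t) * e t = (∫ t in (-r)..(x / 2), F (x - t) * e t)
      + (∫ t in (x / 2)..b, F (x - t) * e t) + ∫ t in b..r, F (x - t) * e t := by
    rw [intervalIntegral.integral_add_adjacent_intervals (hki _ _) (hki _ _),
      intervalIntegral.integral_add_adjacent_intervals (hki _ _) (hki _ _)]
  have hA : ‖∫ t in (-r)..(x / 2), F (x - t) * e t‖ₑ ≤ T := by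
    refine enorm_intervalIntegral_mul_le he1 hms fun t ht => ?_
    rw [Set.uIoc_of_le (by linarith)] at ht
    exact (show x / 2 ≤ x - t by linarith [ht.2]).trans (le_abs_self _)
  have hC : ‖∫ t in b..r, F (x - t) * e t‖ₑ ≤ T := by
    refine enorm_intervalIntegral_mul_le he1 hms fun t ht => ?_
    rw [Set.uIoc_of_le hbr] at ht
    -- The interval is empty unless `b = 3 x / 2`.
    have : 3 * x / 2 < t := by
      rcases min_choice r (3 * x / 2) with h | h
      · rw [← hb] at h; linarith [ht.1, ht.2]
      · rw [← h]; exact ht.1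
    exact (show x / 2 ≤ -(x - t) by linarith).trans (neg_le_abs _)
  have hB : ‖∫ t in (x / 2)..b, F (x - t) * e t‖ₑ
      ≤ ENNReal.ofReal (K / x) * (S + ∫⁻ y in {y : ℝ | |y| ≤ x / 2}, ‖g y‖ₑ) := by
    refine (enorm_integral_primitive_mul_le hg hF he hab
      fun s hs => hK s b hs.1 hs.2 hbx).trans ?_
    gcongr
    · exact hS _
    · intro y hy
      show |y| ≤ x / 2
      exact abs_le.2 ⟨by linarith [hy.1], by linarith [hy.2]⟩
  have hK0 : 0 ≤ K / x := (norm_nonneg _).trans (hK (x / 2) (x / 2) le_rfl le_rfl (by linarith))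
  have hKx : 1 / (2 * r) * (K / x) ≤ K / x ^ 2 := by
    have : K / x ^ 2 = 1 / x * (K / x) := by field_simp
    rw [this]
    refine mul_le_mul_of_nonneg_right (one_div_le_one_div_of_le hx (by linarith)) hK0
  calc ENNReal.ofReal (1 / (2 * r)) * ‖∫ t in (-r)..r, F (x - t) * e t‖ₑ
      ≤ ENNReal.ofReal (1 / (2 * r)) * ((T + T) + ENNReal.ofReal (K / x) *
          (S + ∫⁻ y in {y : ℝ | |y| ≤ x / 2}, ‖g y‖ₑ)) := by
        gcongr
        rw [hsplit, add_right_comm T T]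
        exact (enorm_add_le _ _).trans (add_le_add ((enorm_add_le _ _).trans (add_le_add hA hB)) hC)
    _ ≤ _ := by
        rw [mul_add, ← mul_assoc, ← ENNReal.ofReal_mul (by positivity)]
        gcongr

theorem setLIntegral_comp_neg (G : ℝ → ℝ≥0∞) {s u : Set ℝ} (h : ∀ y, -y ∈ s ↔ y ∈ u)
    (hs : MeasurableSet s) : ∫⁻ y in s, G (-y) = ∫⁻ y in u, G y := by
  have hu : MeasurableSet u := by
    have : u = Neg.neg ⁻¹' s := by ext y; simp [h]
    rw [this]; exact measurable_neg hs
  rw [← lintegral_indicator hs, ← lintegral_indicator hu,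
    ← lintegral_neg_eq_self (u.indicator G)]
  have h' : ∀ y, -y ∈ u ↔ y ∈ s := fun y => by rw [← h, neg_neg]
  refine lintegral_congr fun y => ?_
  by_cases hy : y ∈ s
  · rw [Set.indicator_of_mem hy, Set.indicator_of_mem ((h' y).2 hy)]
  · rw [Set.indicator_of_notMem hy, Set.indicator_of_notMem fun hn => hy ((h' y).1 hn)]

/-- The bound of `average_le_of_pos` on both half-lines; negative `x` are reduced to positive ones by
reflecting `F`, `g` and `e`. -/
theorem average_le {g F e : ℝ → ℂ} (hg : LocallyIntegrable g)
    (hF : ∀ a b, F b - F a = ∫ t in a..b, g t) (he : Continuous e) (he1 : ∀ t, ‖e t‖ = 1)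
    {x w K r : ℝ} {S : ℝ≥0∞} (hx : x ≠ 0) (hw : 1 ≤ w) (hS : ∀ y, ‖F y‖ₑ ≤ S) (hr : 0 < r)
    (hK : ∀ a b, |x| / 2 ≤ a → a ≤ b → b ≤ 3 * |x| / 2 →
      ‖∫ t in a..b, e (SignType.sign x * t)‖ ≤ K / |x|) :
    ENNReal.ofReal (1 / (2 * r)) * ‖∫ t in (-r)..r, F (x - t) * e t‖ₑ
      ≤ ENNReal.ofReal w * (∫⁻ y in Metric.closedBall x 1, ‖F y‖ₑ)
        + (∫⁻ y in Metric.closedBall x (1 / w), ‖g y‖ₑ)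
        + (∫⁻ y in {y : ℝ | |x| / 2 ≤ |y|}, ‖F y‖ₑ)
        + ENNReal.ofReal (K / x ^ 2) * (S + ∫⁻ y in {y : ℝ | |y| ≤ |x| / 2}, ‖g y‖ₑ) := by
  rcases hx.lt_or_gt with hneg | hpos
  · have hg' : LocallyIntegrable fun y => -g (-y) := by
      refine LocallyIntegrable.neg ?_
      intro y
      obtain ⟨s, hs, hi⟩ := hg (-y)
      refine ⟨Neg.neg ⁻¹' s, continuous_neg.continuousAt hs, ?_⟩
      exact (((Measure.measurePreserving_neg volume).integrableOn_comp_preimage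
        (Homeomorph.neg ℝ).measurableEmbedding).2 hi)
    have hF' : ∀ a b, F (-b) - F (-a) = ∫ t in a..b, -g (-t) := by
      intro a b
      rw [intervalIntegral.integral_neg, intervalIntegral.integral_comp_neg (fun t => g t),
        ← intervalIntegral.integral_symm, hF]
    have hm1 : MeasurableSet {y : ℝ | |x| / 2 ≤ |y|} :=
      measurableSet_le measurable_const continuous_abs.measurable
    have hm2 : MeasurableSet {y : ℝ | |y| ≤ |x| / 2} :=
      measurableSet_le continuous_abs.measurable measurable_const
    have key := average_le_of_pos (F := fun y => F (-y)) (e := fun t => e (-t)) hg' hF'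
      (he.comp continuous_neg) (fun t => he1 _) (x := -x) (K := K) (w := w) (by linarith) hw
      (fun y => hS _) hr (by
        have := hK
        rw [abs_of_neg hneg] at this
        simpa [sign_neg hneg] using this)
    have hball : ∀ (ρ y : ℝ), -y ∈ Metric.closedBall (-x) ρ ↔ y ∈ Metric.closedBall x ρ := by
      intro ρ y; simp [dist_neg_neg]
    rw [setLIntegral_comp_neg (fun y => ‖F y‖ₑ) (hball 1) measurableSet_closedBall] at key
    simp only [enorm_neg, abs_neg, neg_sq] at key
    rw [setLIntegral_comp_neg (fun y => ‖g y‖ₑ) (hball _) measurableSet_closedBall,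
      setLIntegral_comp_neg (fun y => ‖F y‖ₑ) (u := {y : ℝ | |x| / 2 ≤ |y|}) (by simp) hm1,
      setLIntegral_comp_neg (fun y => ‖g y‖ₑ) (u := {y : ℝ | |y| ≤ |x| / 2}) (by simp) hm2] at key
    refine le_trans (le_of_eq ?_) key
    have : ∫ t in (-r)..r, F (-(-x - t)) * e (-t) = ∫ t in (-r)..r, F (x - t) * e t := by
      have := intervalIntegral.integral_comp_neg (fun t => F (x - t) * e t) (a := -r) (b := r)
      rw [neg_neg] at this
      rw [← this]
      congr 1 with t
      ring_nf
    rw [this]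
  · refine average_le_of_pos hg hF he he1 hpos hw hS hr ?_
    rw [abs_of_pos hpos] at hK
    simpa [sign_pos hpos] using hK

/-! ### Decay of the oscillatory integrals of the phases -/

/-- A first-derivative van der Corput estimate, with `|h''| ≤ q h' ^ 2` in place of the usual
monotonicity of `h'`. -/
theorem norm_integral_exp_le {h h' h'' : ℝ → ℝ} {a b m q : ℝ} (hab : a ≤ b) (hm : 0 < m)
    (hd : ∀ t ∈ Set.Icc a b, HasDerivAt h (h' t) t)
    (hd' : ∀ t ∈ Set.Icc a b, HasDerivAt h' (h'' t) t)
    (hc : ContinuousOn h'' (Set.Icc a b))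
    (hlow : ∀ t ∈ Set.Icc a b, m ≤ |h' t|) (hup : ∀ t ∈ Set.Icc a b, |h'' t| ≤ q * h' t ^ 2) :
    ‖∫ t in a..b, Complex.exp (Complex.I * (h t : ℂ))‖ ≤ 2 / m + q * (b - a) := by
  set u : ℝ → ℂ := fun t => (Complex.I * (h' t : ℂ))⁻¹ with hu
  set v : ℝ → ℂ := fun t => Complex.exp (Complex.I * (h t : ℂ)) with hv
  set u' : ℝ → ℂ := fun t => -(Complex.I * (h'' t : ℂ)) / (Complex.I * (h' t : ℂ)) ^ 2 with hu'
  set v' : ℝ → ℂ := fun t => Complex.exp (Complex.I * (h t : ℂ)) * (Complex.I * (h' t : ℂ)) with hv'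
  have hI : Set.uIcc a b = Set.Icc a b := Set.uIcc_of_le hab
  have hne : ∀ t ∈ Set.Icc a b, Complex.I * (h' t : ℂ) ≠ 0 := fun t ht => by
    have : h' t ≠ 0 := abs_pos.1 (hm.trans_le (hlow t ht))
    simp [this]
  have hdu : ∀ t ∈ Set.uIcc a b, HasDerivAt u (u' t) t := fun t ht => by
    rw [hI] at ht
    exact ((hd' t ht).ofReal_comp.const_mul Complex.I).inv (hne t ht)
  have hdv : ∀ t ∈ Set.uIcc a b, HasDerivAt v (v' t) t := fun t ht => by
    rw [hI] at ht
    exact ((hd t ht).ofReal_comp.const_mul Complex.I).cexp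
  have ch : ContinuousOn (fun t => (h t : ℂ)) (Set.Icc a b) := fun t ht =>
    (hd t ht).ofReal_comp.continuousAt.continuousWithinAt
  have ch' : ContinuousOn (fun t => (h' t : ℂ)) (Set.Icc a b) := fun t ht =>
    (hd' t ht).ofReal_comp.continuousAt.continuousWithinAt
  have ch'' : ContinuousOn (fun t => (h'' t : ℂ)) (Set.Icc a b) :=
    Complex.continuous_ofReal.comp_continuousOn hc
  have iu' : IntervalIntegrable u' volume a b := by
    refine ContinuousOn.intervalIntegrable ?_
    rw [hI]
    exact (continuousOn_const.mul ch'').neg.div ((continuousOn_const.mul ch').pow 2)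
      fun t ht => pow_ne_zero 2 (hne t ht)
  have iv' : IntervalIntegrable v' volume a b := by
    refine ContinuousOn.intervalIntegrable ?_
    rw [hI]
    exact (Complex.continuous_exp.comp_continuousOn (continuousOn_const.mul ch)).mul
      (continuousOn_const.mul ch')
  have key := intervalIntegral.integral_mul_deriv_eq_deriv_mul hdu hdv iu' iv'
  have e1 : ∫ t in a..b, Complex.exp (Complex.I * (h t : ℂ)) = ∫ t in a..b, u t * v' t := by
    refine intervalIntegral.integral_congr fun t ht => ?_
    rw [hI] at ht
    simp only [hu, hv']
    rw [mul_left_comm, inv_mul_cancel₀ (hne t ht), mul_one]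
  have nv : ∀ t, ‖v t‖ = 1 := fun t => by
    simp only [hv]; rw [mul_comm]; exact Complex.norm_exp_ofReal_mul_I _
  have nu : ∀ t ∈ Set.Icc a b, ‖u t * v t‖ ≤ 1 / m := fun t ht => by
    rw [norm_mul, nv, mul_one, hu]
    simp only [norm_inv, norm_mul, Complex.norm_I, one_mul, Complex.norm_real, Real.norm_eq_abs]
    rw [← one_div]
    exact one_div_le_one_div_of_le hm (hlow t ht)
  rw [e1, key]
  have n3 : ‖∫ t in a..b, u' t * v t‖ ≤ q * (b - a) := by
    have := intervalIntegral.norm_integral_le_of_norm_le_const (a := a) (b := b) (C := q)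
      (f := fun t => u' t * v t) (fun t ht => by
        rw [Set.uIoc_of_le hab] at ht
        have ht' : t ∈ Set.Icc a b := ⟨ht.1.le, ht.2⟩
        have hp : 0 < h' t ^ 2 := by
          have := hm.trans_le (hlow t ht')
          rw [← sq_abs]; positivity
        rw [norm_mul, nv, mul_one, hu']
        simp only [norm_div, norm_neg, norm_mul, norm_pow, Complex.norm_I, one_mul,
          Complex.norm_real, Real.norm_eq_abs, sq_abs]
        rw [div_le_iff₀ hp]
        exact hup t ht')
    rwa [abs_of_nonneg (by linarith)] at this
  have n1 := nu b ⟨hab, le_rfl⟩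
  have n2 := nu a ⟨le_rfl, hab⟩
  calc ‖u b * v b - u a * v a - ∫ t in a..b, u' t * v t‖
      ≤ ‖u b * v b‖ + ‖u a * v a‖ + ‖∫ t in a..b, u' t * v t‖ :=
        (norm_sub_le _ _).trans (add_le_add_left (norm_sub_le _ _) _)
    _ ≤ 1 / m + 1 / m + q * (b - a) := by gcongr
    _ = 2 / m + q * (b - a) := by ring

/-- Past a threshold depending only on the exponents and on `K`, the top term dominates the
derivative of the phase. -/
theorem exists_forall_le_abs_sum_deriv {n : ℕ} {d : Fin (n + 1) → ℝ} (hd : StrictMono d)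
    (hd0 : 2 ≤ d 0) {K : ℝ} (hK : 0 < K) :
    ∃ T : ℝ, 1 ≤ T ∧ ∀ c : Fin (n + 1) → ℝ, (∀ j, |c j| ≤ K) → 1 / K ≤ |c (Fin.last n)| →
      ∀ t, T ≤ t →
        1 / K * t ^ (d (Fin.last n) - 1) ≤ |∑ j, c j * (d j * t ^ (d j - 1))| := by
  set D := d (Fin.last n) with hD
  have hd2 : ∀ j, 2 ≤ d j := fun j => hd0.trans (hd.monotone (Fin.zero_le j))
  have hlim : Filter.Tendsto (fun t : ℝ => ∑ j : Fin n, K * d j.castSucc * t ^ (d j.castSucc - D))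
      Filter.atTop (nhds 0) := by
    rw [show (0 : ℝ) = ∑ _j : Fin n, 0 by simp]
    refine tendsto_finsetSum _ fun j _ => ?_
    have hj : 0 < D - d j.castSucc := sub_pos.2 (hd (Fin.castSucc_lt_last j))
    have := (tendsto_rpow_neg_atTop hj).const_mul (K * d j.castSucc)
    simpa using this
  obtain ⟨T, hT⟩ := Filter.eventually_atTop.1
    ((hlim.eventually_lt_const (show (0 : ℝ) < 1 / K by positivity)).and
      (Filter.eventually_ge_atTop 1))
  refine ⟨max T 1, le_max_right _ _, fun c hc hl t ht => ?_⟩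
  have h1t : 1 ≤ t := (le_max_right _ _).trans ht
  have h0t : 0 < t := by linarith
  have hsmall := (hT t ((le_max_left _ _).trans ht)).1
  have hP : 0 < t ^ (D - 1) := Real.rpow_pos_of_pos h0t _
  rw [Fin.sum_univ_castSucc]
  have hlow : |∑ j : Fin n, c j.castSucc * (d j.castSucc * t ^ (d j.castSucc - 1))|
      ≤ 1 / K * t ^ (D - 1) := by
    calc |∑ j : Fin n, c j.castSucc * (d j.castSucc * t ^ (d j.castSucc - 1))|
        ≤ ∑ j : Fin n, |c j.castSucc * (d j.castSucc * t ^ (d j.castSucc - 1))| :=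
          Finset.abs_sum_le_sum_abs _ _
      _ ≤ ∑ j : Fin n, (K * d j.castSucc * t ^ (d j.castSucc - D)) * t ^ (D - 1) := by
          refine Finset.sum_le_sum fun j _ => ?_
          have h2 := hd2 j.castSucc
          rw [mul_assoc, ← Real.rpow_add h0t, abs_mul,
            abs_of_nonneg (a := d j.castSucc * t ^ (d j.castSucc - 1)) (by positivity), mul_assoc,
            show d j.castSucc - D + (D - 1) = d j.castSucc - 1 by ring]
          exact mul_le_mul_of_nonneg_right (hc _) (by positivity)
      _ = (∑ j : Fin n, K * d j.castSucc * t ^ (d j.castSucc - D)) * t ^ (D - 1) := by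
          rw [Finset.sum_mul]
      _ ≤ 1 / K * t ^ (D - 1) := by gcongr
  have htop : 2 * (1 / K * t ^ (D - 1)) ≤ |c (Fin.last n) * (D * t ^ (D - 1))| := by
    have h2 : 2 ≤ D := hd2 _
    rw [abs_mul, abs_of_nonneg (a := D * t ^ (D - 1)) (by positivity)]
    have : 1 / K * (2 * t ^ (D - 1)) ≤ |c (Fin.last n)| * (D * t ^ (D - 1)) := by gcongr
    linarith
  have := abs_sub_abs_le_abs_sub (c (Fin.last n) * (D * t ^ (D - 1)))
    (-∑ j : Fin n, c j.castSucc * (d j.castSucc * t ^ (d j.castSucc - 1)))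
  rw [abs_neg, sub_neg_eq_add, add_comm (c (Fin.last n) * _)] at this
  linarith

/-- On `[x / 2, 3 x / 2]` the phase satisfies `|h'| ≳ t ^ (D - 1)` and `|h''| ≲ t ^ (D - 2)`, where
`D ≥ 2` is the top exponent, with constants depending only on `K` and the exponents. -/
theorem exists_norm_integral_exp_sum_le {n : ℕ} {d : Fin (n + 1) → ℝ} (hd : StrictMono d)
    (hd0 : 2 ≤ d 0) {K : ℝ} (hK : 0 < K) :
    ∃ B X : ℝ, 0 < X ∧ ∀ c : Fin (n + 1) → ℝ, (∀ j, |c j| ≤ K) → 1 / K ≤ |c (Fin.last n)| →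
      ∀ x, X ≤ x → ∀ a b, x / 2 ≤ a → a ≤ b → b ≤ 3 * x / 2 →
        ‖∫ t in a..b, Complex.exp (Complex.I * ((∑ j, c j * |t| ^ d j : ℝ) : ℂ))‖ ≤ B / x := by
  obtain ⟨T, hT1, hT⟩ := exists_forall_le_abs_sum_deriv hd hd0 hK
  set D := d (Fin.last n) with hD
  have hd2 : ∀ j, 2 ≤ d j := fun j => hd0.trans (hd.monotone (Fin.zero_le j))
  have hD2 : 2 ≤ D := hd2 _
  set L : ℝ := ∑ j, K * (d j * (d j - 1)) with hL
  have hL0 : 0 ≤ L := Finset.sum_nonneg fun j _ => by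
    have := hd2 j
    have : 0 ≤ d j - 1 := by linarith
    positivity
  refine ⟨4 * K + 4 * (L * K ^ 2), 2 * T, by linarith, fun c hc hl x hx a b hxa hab hbx => ?_⟩
  have hTa : T ≤ a := by linarith
  have ha1 : 1 ≤ a := hT1.trans hTa
  have hcongr : ∫ t in a..b, Complex.exp (Complex.I * ((∑ j, c j * |t| ^ d j : ℝ) : ℂ))
      = ∫ t in a..b, Complex.exp (Complex.I * ((∑ j, c j * t ^ d j : ℝ) : ℂ)) := by
    refine intervalIntegral.integral_congr fun t ht => ?_
    rw [Set.uIcc_of_le hab] at ht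
    simp only [abs_of_nonneg (show 0 ≤ t by linarith [ht.1])]
  rw [hcongr]
  have hmain := norm_integral_exp_le (h := fun t => ∑ j, c j * t ^ d j)
    (h' := fun t => ∑ j, c j * (d j * t ^ (d j - 1)))
    (h'' := fun t => ∑ j, c j * (d j * ((d j - 1) * t ^ (d j - 1 - 1))))
    (a := a) (b := b) (m := 1 / K * a) (q := L * K ^ 2 / a ^ 2) hab (by positivity)
    (fun t ht => HasDerivAt.fun_sum fun j _ => by
      have ht0 : t ≠ 0 := by linarith [ht.1]
      exact (Real.hasDerivAt_rpow_const (Or.inl ht0)).const_mul (c j))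
    (fun t ht => HasDerivAt.fun_sum fun j _ => by
      have ht0 : t ≠ 0 := by linarith [ht.1]
      exact ((Real.hasDerivAt_rpow_const (Or.inl ht0)).const_mul (d j)).const_mul (c j))
    (by
      refine continuousOn_finsetSum _ fun j _ => ?_
      refine continuousOn_const.mul (continuousOn_const.mul (continuousOn_const.mul ?_))
      exact continuousOn_id.rpow_const fun t ht => Or.inl (by simp only [id]; linarith [ht.1]))
    (fun t ht => by
      have ht0 : 0 < t := by linarith [ht.1]
      refine le_trans ?_ (hT c hc hl t (hTa.trans ht.1))
      gcongr
      calc a ≤ t := ht.1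
        _ = t ^ (1 : ℝ) := (Real.rpow_one t).symm
        _ ≤ t ^ (D - 1) := Real.rpow_le_rpow_of_exponent_le (by linarith [ht.1]) (by linarith))
    (fun t ht => by
      have ht0 : 0 < t := by linarith [ht.1]
      have ht1 : 1 ≤ t := by linarith [ht.1]
      have hl' := hT c hc hl t (hTa.trans ht.1)
      have h1 : |∑ j, c j * (d j * ((d j - 1) * t ^ (d j - 1 - 1)))| ≤ L * t ^ (D - 2) := by
        refine (Finset.abs_sum_le_sum_abs _ _).trans ?_
        rw [hL, Finset.sum_mul]
        refine Finset.sum_le_sum fun j _ => ?_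
        have hj1 : 0 ≤ d j - 1 := by linarith [hd2 j]
        have hj0 : 0 ≤ d j := by linarith [hd2 j]
        rw [abs_mul, abs_of_nonneg (a := d j * ((d j - 1) * t ^ (d j - 1 - 1))) (by positivity)]
        have : t ^ (d j - 1 - 1) ≤ t ^ (D - 2) :=
          Real.rpow_le_rpow_of_exponent_le ht1 (by
            have := hd.monotone (Fin.le_last j); linarith)
        calc |c j| * (d j * ((d j - 1) * t ^ (d j - 1 - 1)))
            ≤ K * (d j * ((d j - 1) * t ^ (D - 2))) := by gcongr; exact hc j
          _ = _ := by ring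
      refine h1.trans ?_
      have h2 : (1 / K * t ^ (D - 1)) ^ 2 ≤ (∑ j, c j * (d j * t ^ (d j - 1))) ^ 2 := by
        rw [← sq_abs (∑ j, c j * (d j * t ^ (d j - 1)))]
        gcongr
      -- `t ^ (2 (D - 1)) = t ^ (D - 2) t ^ D`, and `t ^ D ≥ t ^ 2 ≥ a ^ 2`.
      have h3 : t ^ (D - 2) * a ^ 2 ≤ (t ^ (D - 1)) ^ 2 := by
        have e : (t ^ (D - 1)) ^ 2 = t ^ (D - 2) * t ^ D := by
          rw [← Real.rpow_natCast, ← Real.rpow_mul ht0.le, ← Real.rpow_add ht0]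
          congr 1; push_cast; ring
        rw [e]
        have : a ^ 2 ≤ t ^ D := by
          calc a ^ 2 ≤ t ^ 2 := by have := ht.1; gcongr
            _ = t ^ (2 : ℝ) := (Real.rpow_two t).symm
            _ ≤ t ^ D := Real.rpow_le_rpow_of_exponent_le ht1 hD2
        gcongr
      calc L * t ^ (D - 2) = L * K ^ 2 / a ^ 2 * ((1 / K) ^ 2 * (t ^ (D - 2) * a ^ 2)) := by
            field_simp
        _ ≤ L * K ^ 2 / a ^ 2 * ((1 / K) ^ 2 * (t ^ (D - 1)) ^ 2) := by gcongr
        _ ≤ _ := by rw [← mul_pow]; gcongr)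
  refine hmain.trans ?_
  have hx0 : 0 < x := by linarith
  have ha0 : 0 < a := by linarith
  have e1 : 2 / (1 / K * a) ≤ 4 * K / x := by
    rw [show 2 / (1 / K * a) = 2 * K / a by field_simp, div_le_div_iff₀ ha0 hx0]
    nlinarith
  have e2 : L * K ^ 2 / a ^ 2 * (b - a) ≤ 4 * (L * K ^ 2) / x := by
    have h0 : 0 ≤ L * K ^ 2 := by positivity
    rw [div_mul_eq_mul_div, div_le_div_iff₀ (by positivity) hx0]
    have : (b - a) * x ≤ 4 * a ^ 2 := by nlinarith
    nlinarith
  calc _ ≤ 4 * K / x + 4 * (L * K ^ 2) / x := add_le_add e1 e2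
    _ = _ := by ring

/-- Uniform decay, over all windows at distance comparable to `|x|` from the origin and on the
same side as `x`, of the oscillatory integrals with phase `γ (x, ·)`. -/
def HasOscDecay (γ : ℝ → ℝ → ℝ) : Prop :=
  ∃ B X : ℝ, 0 < X ∧ ∀ᵐ x : ℝ, X ≤ |x| → ∀ a b, |x| / 2 ≤ a → a ≤ b → b ≤ 3 * |x| / 2 →
    ‖∫ t in a..b, Complex.exp (Complex.I * (γ x (SignType.sign x * t) : ℂ))‖ ≤ B / |x|

theorem hasOscDecay_of_sum {γ : ℝ → ℝ → ℝ} {n : ℕ} {c : Fin (n + 1) → ℝ → ℝ}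
    {d : Fin (n + 1) → ℝ} (hd : StrictMono d) (hd0 : 2 ≤ d 0) {K : ℝ} (hK : 0 < K)
    (hc : ∀ᵐ x, (∀ j, |c j x| ≤ K) ∧ 1 / K ≤ |c (Fin.last n) x|)
    (hγ : ∀ x t, x ≠ 0 → 0 < t → γ x (SignType.sign x * t) = ∑ j, c j x * |t| ^ d j) :
    HasOscDecay γ := by
  obtain ⟨B, X, hX, h⟩ := exists_norm_integral_exp_sum_le hd hd0 hK
  refine ⟨B, X, hX, ?_⟩
  filter_upwards [hc] with x hx hXx a b hxa hab hbx
  have hx0 : x ≠ 0 := abs_pos.1 (hX.trans_le hXx)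
  rw [← show ∫ t in a..b, Complex.exp (Complex.I * ((∑ j, c j x * |t| ^ d j : ℝ) : ℂ))
      = ∫ t in a..b, Complex.exp (Complex.I * (γ x (SignType.sign x * t) : ℂ)) from
    intervalIntegral.integral_congr fun t ht => by
      rw [Set.uIcc_of_le hab] at ht
      rw [hγ x t hx0 (by linarith [ht.1])]]
  exact h (fun j => c j x) hx.1 hx.2 _ hXx a b hxa hab hbx

theorem exists_ae_abs_le_of_memLp_top {c : ℝ → ℝ} (hc : MemLp c ⊤ volume) :
    ∃ K : ℝ, 0 ≤ K ∧ ∀ᵐ x, |c x| ≤ K := by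
  refine ⟨(eLpNorm c ⊤ volume).toReal, ENNReal.toReal_nonneg, ?_⟩
  filter_upwards [ae_le_eLpNormEssSup (f := c) (μ := volume)] with x hx
  rw [← eLpNorm_exponent_top] at hx
  have := ENNReal.toReal_mono hc.eLpNorm_ne_top hx
  simpa using this

/-- The lower bound for `|c|` is stated without division; at a zero of `c` the bound on `1 / c` would
say nothing. -/
theorem BddWithInv.exists_ae_le_abs {c : ℝ → ℝ} (hc : BddWithInv c) :
    ∃ K : ℝ, 0 ≤ K ∧ ∀ᵐ x, 1 ≤ K * |c x| := by
  obtain ⟨K, hK0, hK⟩ := exists_ae_abs_le_of_memLp_top hc.memLp_inv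
  refine ⟨K, hK0, ?_⟩
  filter_upwards [hK, hc.ne_zero] with x hx hne
  rwa [abs_div, abs_one, div_le_iff₀ (abs_pos.2 hne)] at hx

theorem hasOscDecay_of_memLp {γ : ℝ → ℝ → ℝ} {n : ℕ} {c : Fin (n + 1) → ℝ → ℝ}
    {d : Fin (n + 1) → ℝ} (hd : StrictMono d) (hd0 : 2 ≤ d 0)
    (hc : ∀ j, MemLp (c j) ⊤ volume) (hl : BddWithInv (c (Fin.last n)))
    (hγ : ∀ x t, γ x t = ∑ j, c j x * |t| ^ d j) : HasOscDecay γ := by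
  choose K hK0 hK using fun j => exists_ae_abs_le_of_memLp_top (hc j)
  obtain ⟨k, hk0, hk⟩ := hl.exists_ae_le_abs
  have hs : 0 ≤ ∑ j, K j := Finset.sum_nonneg fun j _ => hK0 j
  have hM : 0 < (∑ j, K j) + k + 1 := by linarith
  refine hasOscDecay_of_sum hd hd0 hM (c := c) ?_ fun x t hx ht => ?_
  · filter_upwards [ae_all_iff.2 hK, hk] with x hx hkx
    refine ⟨fun j => (hx j).trans ?_, ?_⟩
    · have := Finset.single_le_sum (fun i _ => hK0 i) (Finset.mem_univ j)
      linarith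
    · rw [div_le_iff₀ hM]
      have := abs_nonneg (c (Fin.last n) x)
      nlinarith
  · rw [hγ]
    have : |(SignType.sign x : ℝ) * t| = |t| := by
      rcases hx.lt_or_gt with h | h
      · simp [sign_neg h]
      · simp [sign_pos h]
    rw [this]

/-- The properties of a phase that the maximal estimate uses. -/
structure IsGoodPhase (γ : ℝ → ℝ → ℝ) : Prop where
  continuous : ∀ x, Continuous (γ x)
  aemeasurable : AEMeasurable (Function.uncurry γ) (volume.prod volume)
  decay : HasOscDecay γ

theorem isGoodPhase_of_memLp {γ : ℝ → ℝ → ℝ} {n : ℕ} {c : Fin (n + 1) → ℝ → ℝ}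
    {d : Fin (n + 1) → ℝ} (hd : StrictMono d) (hd0 : 2 ≤ d 0)
    (hc : ∀ j, MemLp (c j) ⊤ volume) (hl : BddWithInv (c (Fin.last n)))
    (hγ : ∀ x t, γ x t = ∑ j, c j x * |t| ^ d j) : IsGoodPhase γ := by
  have hd2 : ∀ j, 0 ≤ d j := fun j => by
    linarith [hd.monotone (Fin.zero_le j)]
  have hcont : ∀ j, Continuous fun t : ℝ => |t| ^ d j := fun j =>
    continuous_abs.rpow_const fun _ => Or.inr (hd2 j)
  refine ⟨fun x => ?_, ?_, hasOscDecay_of_memLp hd hd0 hc hl hγ⟩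
  · rw [show γ x = fun t => ∑ j, c j x * |t| ^ d j from funext (hγ x)]
    exact continuous_finsetSum _ fun j _ => continuous_const.mul (hcont j)
  · rw [show Function.uncurry γ = fun z : ℝ × ℝ => ∑ j, c j z.1 * |z.2| ^ d j from
      funext fun z => hγ z.1 z.2]
    refine Finset.aemeasurable_fun_sum _ fun j _ => ?_
    exact ((hc j).aemeasurable.comp_quasiMeasurePreserving Measure.quasiMeasurePreserving_fst).mul
      ((hcont j).measurable.comp measurable_snd).aemeasurable

theorem IsSumPhase.isGoodPhase {γ : ℝ → ℝ → ℝ} (h : IsSumPhase γ) : IsGoodPhase γ := by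
  obtain ⟨n, c, d, hd, hd0, -, hc, hl, hγ⟩ := h
  exact isGoodPhase_of_memLp hd hd0 hc hl hγ

theorem IsQuadraticPhase.isGoodPhase {γ : ℝ → ℝ → ℝ} (h : IsQuadraticPhase γ) :
    IsGoodPhase γ := by
  obtain ⟨a, ha, hγ⟩ := h
  refine isGoodPhase_of_memLp (n := 0) (c := fun _ => a) (d := fun _ => 2)
    (Subsingleton.strictMono (α := Fin 1) _) le_rfl (fun _ => ha.memLp) ha fun x t => ?_
  simp [hγ]

theorem IsMonomialPhase.isGoodPhase {γ : ℝ → ℝ → ℝ} (h : IsMonomialPhase γ) :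
    IsGoodPhase γ := by
  obtain ⟨k, hk, hγ⟩ := h
  have hu : Function.uncurry γ = fun z : ℝ × ℝ => z.2 ^ k := funext fun z => hγ z.1 z.2
  refine ⟨fun x => ?_, ?_, ?_⟩
  · rw [show γ x = fun t => t ^ k from funext (hγ x)]
    exact continuous_pow k
  · rw [hu]; exact (measurable_snd.pow_const k).aemeasurable
  · refine hasOscDecay_of_sum (n := 0) (c := fun _ x => (SignType.sign x : ℝ) ^ k)
      (d := fun _ => (k : ℝ)) (K := 1) (Subsingleton.strictMono (α := Fin 1) _) (by exact_mod_cast hk)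
      one_pos ?_ fun x t _ ht => ?_
    · have h0 : ∀ᵐ x : ℝ, x ≠ 0 := by simp [ae_iff, measure_singleton]
      filter_upwards [h0] with x hx
      have : |(SignType.sign x : ℝ) ^ k| = 1 := by
        rw [abs_pow]
        rcases hx.lt_or_gt with h | h
        · simp [sign_neg h]
        · simp [sign_pos h]
      simp [this]
    · rw [hγ]
      simp [mul_pow, abs_of_pos ht]

/-! ### Integrals over tails and over moving balls -/

theorem integrableOn_comp_abs {f : ℝ → ℝ} {R : ℝ} (hR : 0 ≤ R)
    (h : IntegrableOn f (Set.Ioi R)) : IntegrableOn (fun x => f |x|) {x : ℝ | R < |x|} := by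
  have hset : {x : ℝ | R < |x|} = Set.Ioi R ∪ Neg.neg ⁻¹' Set.Ioi R := by
    ext x; simp [lt_abs, lt_neg]
  rw [hset, integrableOn_union]
  constructor
  · refine h.congr_fun (fun x hx => ?_) measurableSet_Ioi
    rw [abs_of_pos (hR.trans_lt hx)]
  · have := ((Measure.measurePreserving_neg (volume : Measure ℝ)).integrableOn_comp_preimage
      (Homeomorph.neg ℝ).measurableEmbedding).2 h
    refine this.congr_fun (fun x hx => ?_) (measurable_neg measurableSet_Ioi)
    have hx' : R < -x := hx
    simp only [Function.comp_apply]
    rw [abs_of_neg (by linarith)]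

/-- An `L^1 ∩ L^∞` weight pairs with `L^p` for every `p`, since `w ^ q ≤ w` for the conjugate
exponent `q`. -/
theorem lintegral_enorm_mul_le_eLpNorm_mul {p : ℝ≥0∞} (h1 : 1 ≤ p) (hp : p < ⊤) {g : ℝ → ℂ}
    (hg : AEStronglyMeasurable g volume) {w : ℝ → ℝ≥0∞} (hw : AEMeasurable w volume)
    (hw1 : ∀ x, w x ≤ 1) :
    ∫⁻ x, ‖g x‖ₑ * w x ≤ eLpNorm g p volume * (∫⁻ x, w x) ^ (1 - 1 / p.toReal) := by
  rcases h1.eq_or_lt with rfl | h1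
  · simp only [ENNReal.toReal_one, div_one, sub_self, ENNReal.rpow_zero, mul_one,
      eLpNorm_one_eq_lintegral_enorm]
    exact lintegral_mono fun x => mul_le_of_le_one_right' (hw1 x)
  · have hpr : 1 < p.toReal := by
      rw [← ENNReal.toReal_one]; exact (ENNReal.toReal_lt_toReal ENNReal.one_ne_top hp.ne).2 h1
    have hpq := Real.HolderConjugate.conjExponent hpr
    have hq : 1 ≤ p.toReal.conjExponent := hpq.symm.lt.le
    have := ENNReal.lintegral_mul_le_Lp_mul_Lq volume hpq hg.enorm hw
    refine this.trans ?_
    rw [eLpNorm_eq_lintegral_rpow_enorm_toReal (by positivity) hp.ne]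
    have he : 1 / p.toReal.conjExponent = 1 - 1 / p.toReal := by
      have := hpq.inv_add_inv_eq_one
      rw [one_div, one_div]; linarith
    rw [he]
    have he0 : 0 ≤ 1 - 1 / p.toReal := by rw [← he]; positivity
    gcongr with x
    calc w x ^ p.toReal.conjExponent ≤ w x ^ (1 : ℝ) :=
          ENNReal.rpow_le_rpow_of_exponent_ge (hw1 x) hq
      _ = w x := ENNReal.rpow_one _

theorem setLIntegral_enorm_le_eLpNorm_mul {p : ℝ≥0∞} (h1 : 1 ≤ p) (hp : p < ⊤) {g : ℝ → ℂ}
    (hg : AEStronglyMeasurable g volume) {s : Set ℝ} (hs : MeasurableSet s) :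
    ∫⁻ x in s, ‖g x‖ₑ ≤ eLpNorm g p volume * volume s ^ (1 - 1 / p.toReal) := by
  have := lintegral_enorm_mul_le_eLpNorm_mul h1 hp hg (w := s.indicator 1)
    (aemeasurable_one.indicator hs) (fun x => Set.indicator_le_self' (by simp) x)
  rw [lintegral_indicator_one hs] at this
  refine le_trans (le_of_eq ?_) this
  rw [← lintegral_indicator hs]
  refine lintegral_congr fun x => ?_
  by_cases hx : x ∈ s <;> simp [hx]

theorem aemeasurable_uncurry_indicator_ball {G : ℝ → ℝ≥0∞} {ρ : ℝ → ℝ}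
    (hG : AEMeasurable G volume) (hρ : AEMeasurable ρ volume) :
    AEMeasurable (Function.uncurry fun x y : ℝ =>
      {z : ℝ × ℝ | |z.1 - z.2| ≤ ρ z.2}.indicator (fun z => G z.2) (x, y))
      (volume.prod volume) := by
  refine AEMeasurable.indicator₀ (f := fun z : ℝ × ℝ => G z.2) ?_ ?_
  · exact hG.comp_quasiMeasurePreserving Measure.quasiMeasurePreserving_snd
  · exact nullMeasurableSet_le (by fun_prop : Measurable fun z : ℝ × ℝ => |z.1 - z.2|).aemeasurable
      (hρ.comp_quasiMeasurePreserving Measure.quasiMeasurePreserving_snd)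

/-- Averaging over balls whose radius is governed by the point `y` of integration: each `y` is seen
from a set of `x` of measure `2 ρ y`. -/
theorem lintegral_lintegral_indicator_ball {G : ℝ → ℝ≥0∞} {ρ : ℝ → ℝ}
    (hG : AEMeasurable G volume) (hρ : AEMeasurable ρ volume) :
    ∫⁻ x, ∫⁻ y, {z : ℝ × ℝ | |z.1 - z.2| ≤ ρ z.2}.indicator (fun z => G z.2) (x, y)
      = ∫⁻ y, G y * ENNReal.ofReal (2 * ρ y) := by
  rw [lintegral_lintegral_swap (aemeasurable_uncurry_indicator_ball hG hρ)]
  refine lintegral_congr fun y => ?_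
  have : (fun x => {z : ℝ × ℝ | |z.1 - z.2| ≤ ρ z.2}.indicator (fun z => G z.2) (x, y))
      = (Metric.closedBall y (ρ y)).indicator fun _ => G y := by
    ext x; simp [Set.indicator, Real.dist_eq]
  rw [this, lintegral_indicator measurableSet_closedBall, setLIntegral_const,
    Real.volume_closedBall]

/-- Passage from a ball whose radius depends on its centre `x` to the condition
`|x - y| ≤ ρ y`, to which `lintegral_lintegral_indicator_ball` applies. -/
theorem setLIntegral_le_lintegral_indicator_ball {f G : ℝ → ℝ≥0∞} {ρ : ℝ → ℝ} {x r : ℝ}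
    (h : ∀ y, |x - y| ≤ r → |x - y| ≤ ρ y ∧ f y ≤ G y) :
    ∫⁻ y in Metric.closedBall x r, f y
      ≤ ∫⁻ y, {z : ℝ × ℝ | |z.1 - z.2| ≤ ρ z.2}.indicator (fun z => G z.2) (x, y) := by
  rw [← lintegral_indicator measurableSet_closedBall]
  refine lintegral_mono fun y => ?_
  by_cases hy : y ∈ Metric.closedBall x r
  · rw [Metric.mem_closedBall, dist_comm, Real.dist_eq] at hy
    have := h y hy
    rw [Set.indicator_of_mem (by rwa [Metric.mem_closedBall, dist_comm, Real.dist_eq]),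
      Set.indicator_of_mem (show (x, y) ∈ {z : ℝ × ℝ | |z.1 - z.2| ≤ ρ z.2} from this.1)]
    exact this.2
  · rw [Set.indicator_of_notMem hy]
    exact zero_le

/-! ### Admissible weights -/

/-- The form in which the hypotheses on the weight are used: monotonicity and doubling combine to
`φ x ≤ D φ y` for large `x` whenever `|y| ≥ |x| / 2`. -/
theorem IsAdmissibleWeight.exists_tail {φ : ℝ → ℝ} (h : IsAdmissibleWeight φ) :
    ∃ X D : ℝ, 1 ≤ X ∧ 0 < D ∧ (∀ x y, X ≤ |x| → |x| / 2 ≤ |y| → φ x ≤ D * φ y) ∧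
      (∀ x, X ≤ |x| → 1 ≤ φ x) ∧
      ∫⁻ x in {x : ℝ | X ≤ |x|}, ENNReal.ofReal (1 / φ x) ≠ ⊤ := by
  obtain ⟨c, hc, hlow⟩ := h.lower_bound
  obtain ⟨R, hR⟩ := h.eventually_mono
  obtain ⟨D, hD⟩ := h.doubling
  obtain ⟨R', hR'0, hR'⟩ := h.integrable_inv
  have habs : ∀ x, φ |x| = φ x := fun x => by
    rcases abs_choice x with hx | hx <;> rw [hx]
    exact h.radial x
  have hpos : ∀ x, 0 < φ x := fun x =>
    lt_of_lt_of_le (mul_pos hc (by positivity)) (hlow x)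
  -- The threshold exceeds `2 R`, so that `φ` is monotone from `|x| / 2` on, `1 / c`, so that
  -- `φ x ≥ c |x| ≥ 1`, and `R'`, so that `1 / φ` is integrable beyond it.
  refine ⟨1 + 2 * |R| + 1 / c + R', max D 1, ?_, by positivity, fun x y hx hxy => ?_,
    fun x hx => ?_, ?_⟩
  · have := abs_nonneg R
    have : 0 < 1 / c := by positivity
    linarith
  · have hc' : 0 < 1 / c := by positivity
    have hRx : R ≤ |x| / 2 := by
      have := le_abs_self R
      linarith
    have h1 := hD (|x| / 2)
    rw [show 2 * (|x| / 2) = |x| by ring, habs] at h1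
    have h2 := hR (Set.mem_Ici.2 hRx) (Set.mem_Ici.2 (hRx.trans hxy)) hxy
    rw [habs] at h2
    calc φ x ≤ D * φ (|x| / 2) := h1
      _ ≤ max D 1 * φ (|x| / 2) := mul_le_mul_of_nonneg_right (le_max_left _ _) (hpos _).le
      _ ≤ max D 1 * φ y := by gcongr
  · have : 1 / c ≤ |x| := by have := abs_nonneg R; linarith
    rw [div_le_iff₀ hc] at this
    have := hlow x
    nlinarith
  · have hsub : {x : ℝ | 1 + 2 * |R| + 1 / c + R' ≤ |x|} ⊆ {x : ℝ | R' < |x|} := fun x hx => by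
      have hx' : 1 + 2 * |R| + 1 / c + R' ≤ |x| := hx
      have := abs_nonneg R
      have : 0 < 1 / c := by positivity
      show R' < |x|
      linarith
    exact (hR'.mono_set hsub).lintegral_lt_top.ne

theorem lintegral_abs_rpow_tail_ne_top {s X : ℝ} (hs : s < -1) (hX : 0 < X) (B : ℝ) :
    ∫⁻ x in {x : ℝ | X ≤ |x|}, ENNReal.ofReal (B * |x| ^ s) ≠ ⊤ := by
  have h := integrableOn_comp_abs (by positivity : 0 ≤ X / 2)
    ((integrableOn_Ioi_rpow_of_lt hs (by positivity : 0 < X / 2)).const_mul B)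
  refine (h.mono_set fun x hx => ?_).lintegral_lt_top.ne
  have hx' : X ≤ |x| := hx
  show X / 2 < |x|
  linarith

/-! ### The maximal estimate -/

/-- A Sobolev bound for `sup |F|`, from the fundamental theorem of calculus on an interval of
length one. -/
theorem enorm_le_lintegral_add_eLpNorm {p : ℝ≥0∞} (h1 : 1 ≤ p) (hp : p < ⊤) {g F : ℝ → ℂ}
    (hg : MemLp g p volume) (hF : ∀ a b, F b - F a = ∫ t in a..b, g t) (x : ℝ) :
    ‖F x‖ₑ ≤ (∫⁻ y, ‖F y‖ₑ) + eLpNorm g p volume := by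
  have := enorm_le_average_add_of_primitive hF (a := x) (b := x + 1) (x := x) (by linarith)
    ⟨le_rfl, by linarith⟩
  refine this.trans (add_le_add ?_ ?_)
  · simp only [add_sub_cancel_left, div_one, ENNReal.ofReal_one, one_mul]
    exact setLIntegral_le_lintegral _ _
  · simpa using setLIntegral_enorm_le_eLpNorm_mul h1 hp hg.1 (measurableSet_Icc (a := x) (b := x + 1))

/-- Outside a large ball, every average of `F` is dominated by four functions of `x`, each of
which is integrable with the right bound. -/
theorem oscMaximal_le_of_large {p : ℝ≥0∞} (h1 : 1 ≤ p) (hp : p < ⊤) {φ : ℝ → ℝ} {γ : ℝ → ℝ → ℝ}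
    {X D B x : ℝ} (hX : 1 ≤ X) (hD : 0 < D)
    (hφ : ∀ x y, X ≤ |x| → |x| / 2 ≤ |y| → φ x ≤ D * φ y) (hφ1 : ∀ x, X ≤ |x| → 1 ≤ φ x)
    (hγ : Continuous (γ x)) (hx : X + 1 ≤ |x|)
    (hB : ∀ a b, |x| / 2 ≤ a → a ≤ b → b ≤ 3 * |x| / 2 →
      ‖∫ t in a..b, Complex.exp (Complex.I * (γ x (SignType.sign x * t) : ℂ))‖ ≤ B / |x|)
    {g F : ℝ → ℂ} (hgl : LocallyIntegrable g) (hg : MemLp g p volume)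
    (hF : ∀ a b, F b - F a = ∫ t in a..b, g t) {S : ℝ≥0∞} (hS : ∀ y, ‖F y‖ₑ ≤ S) :
    oscMaximal γ F x ≤
      (∫⁻ y, {z : ℝ × ℝ | |z.1 - z.2| ≤ (fun _ => 1) z.2}.indicator
        (fun z => ENNReal.ofReal D * ‖(φ z.2 : ℂ) * F z.2‖ₑ) (x, y))
      + (∫⁻ y, {z : ℝ × ℝ | |z.1 - z.2| ≤ {y : ℝ | X ≤ |y|}.indicator
          (fun y => D * (1 / φ y)) z.2}.indicator (fun z => ‖g z.2‖ₑ) (x, y))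
      + ENNReal.ofReal (1 / φ x) * (ENNReal.ofReal D * ∫⁻ y, ‖(φ y : ℂ) * F y‖ₑ)
      + ENNReal.ofReal (B * |x| ^ (-1 - 1 / p.toReal)) * (S + eLpNorm g p volume) := by
  have hx0 : 0 < |x| := by linarith
  have hXx : X ≤ |x| := by linarith
  have hw := hφ1 x hXx
  have hw0 : 0 < φ x := by linarith
  have hmul : ∀ y, |x| / 2 ≤ |y| →
      ENNReal.ofReal (φ x) * ‖F y‖ₑ ≤ ENNReal.ofReal D * ‖(φ y : ℂ) * F y‖ₑ := fun y hy => by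
    have h2 := hφ x y hXx hy
    have h3 : 0 < φ y := by
      by_contra hn
      nlinarith
    rw [enorm_mul, ← mul_assoc, ← ofReal_norm (φ y : ℂ), Complex.norm_real, Real.norm_eq_abs,
      abs_of_pos h3, ← ENNReal.ofReal_mul hD.le]
    gcongr
  refine iSup₂_le fun r hr => ?_
  have hbd := average_le hgl hF (e := fun t => Complex.exp (Complex.I * (γ x t : ℂ)))
    (by fun_prop) (fun t => by rw [mul_comm]; exact Complex.norm_exp_ofReal_mul_I _)
    (x := x) (abs_pos.1 hx0) hw hS hr hB
  refine hbd.trans (add_le_add (add_le_add (add_le_add ?_ ?_) ?_) ?_)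
  · rw [← lintegral_const_mul' _ _ ENNReal.ofReal_ne_top]
    refine setLIntegral_le_lintegral_indicator_ball (ρ := fun _ => 1)
      (G := fun y => ENNReal.ofReal D * ‖(φ y : ℂ) * F y‖ₑ) fun y hy => ⟨hy, hmul y ?_⟩
    have := abs_sub_abs_le_abs_sub x y
    linarith
  · refine setLIntegral_le_lintegral_indicator_ball (G := fun y => ‖g y‖ₑ)
      (ρ := {y : ℝ | X ≤ |y|}.indicator (fun y => D * (1 / φ y))) fun y hy => ⟨?_, le_rfl⟩
    have h1w : 1 / φ x ≤ 1 := by rw [div_le_one hw0]; exact hw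
    have a1 := abs_sub_abs_le_abs_sub x y
    have a2 := abs_sub_abs_le_abs_sub y x
    rw [abs_sub_comm] at a2
    have hy1 : X ≤ |y| := by linarith
    rw [Set.indicator_of_mem (show y ∈ {y : ℝ | X ≤ |y|} from hy1)]
    refine hy.trans ?_
    have h3 := hφ y x hy1 (by linarith)
    have h4 := hφ1 y hy1
    rw [mul_one_div, div_le_div_iff₀ hw0 (by linarith)]
    linarith
  · have hm : MeasurableSet {y : ℝ | |x| / 2 ≤ |y|} :=
      measurableSet_le measurable_const continuous_abs.measurable
    have hcancel : ENNReal.ofReal (1 / φ x) * ENNReal.ofReal (φ x) = 1 := by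
      rw [← ENNReal.ofReal_mul (by positivity), one_div_mul_cancel hw0.ne', ENNReal.ofReal_one]
    rw [← lintegral_const_mul' _ _ ENNReal.ofReal_ne_top,
      ← lintegral_const_mul' _ _ ENNReal.ofReal_ne_top]
    refine (setLIntegral_mono' hm fun y hy => ?_).trans (setLIntegral_le_lintegral _ _)
    calc ‖F y‖ₑ = ENNReal.ofReal (1 / φ x) * (ENNReal.ofReal (φ x) * ‖F y‖ₑ) := by
          rw [← mul_assoc, hcancel, one_mul]
      _ ≤ _ := mul_le_mul_right (hmul y hy) _
  · have hm : MeasurableSet {y : ℝ | |y| ≤ |x| / 2} :=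
      measurableSet_le continuous_abs.measurable measurable_const
    have hpr : 1 ≤ p.toReal := by
      rw [← ENNReal.toReal_one]; exact (ENNReal.toReal_le_toReal ENNReal.one_ne_top hp.ne).2 h1
    have hs : 0 ≤ 1 - 1 / p.toReal := by
      rw [sub_nonneg, div_le_one (by linarith)]; exact hpr
    have hvol : volume {y : ℝ | |y| ≤ |x| / 2} = ENNReal.ofReal |x| := by
      have : {y : ℝ | |y| ≤ |x| / 2} = Metric.closedBall 0 (|x| / 2) := by
        ext y; simp
      rw [this, Real.volume_closedBall]
      congr 1; ring
    have hI := setLIntegral_enorm_le_eLpNorm_mul h1 hp hg.1 hm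
    rw [hvol, ENNReal.ofReal_rpow_of_nonneg hx0.le hs] at hI
    have hone : 1 ≤ ENNReal.ofReal (|x| ^ (1 - 1 / p.toReal)) := by
      rw [ENNReal.one_le_ofReal]
      exact Real.one_le_rpow (by linarith) hs
    have hpow : B * |x| ^ (-1 - 1 / p.toReal) = B / x ^ 2 * |x| ^ (1 - 1 / p.toReal) := by
      rw [show -1 - 1 / p.toReal = (1 - 1 / p.toReal) - 2 by ring, Real.rpow_sub hx0,
        Real.rpow_two, sq_abs]
      ring
    rw [hpow, ENNReal.ofReal_mul' (by positivity), mul_assoc]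
    gcongr
    rw [mul_add]
    refine add_le_add ?_ (hI.trans_eq (mul_comm _ _))
    exact le_mul_of_one_le_left' hone

theorem lintegral_oscMaximal_le {p : ℝ≥0∞} (h1 : 1 ≤ p) (hp : p < ⊤) {γ : ℝ → ℝ → ℝ}
    (hγ : IsGoodPhase γ) {φ : ℝ → ℝ} (hφ : IsAdmissibleWeight φ) :
    ∃ C : ℝ≥0, ∀ g F : ℝ → ℂ, LocallyIntegrable g → MemLp g p volume →
      (∀ a b, F b - F a = ∫ t in a..b, g t) →
      ∫⁻ x, oscMaximal γ F x ≤ C * ((∫⁻ y, ‖(φ y : ℂ) * F y‖ₑ) + eLpNorm g p volume) := by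
  obtain ⟨X₀, D, hX₀, hD, hcmp, hone, hI⟩ := hφ.exists_tail
  obtain ⟨B, X₁, hX₁, hdecay⟩ := hγ.decay
  obtain ⟨c, hc, hlow⟩ := hφ.lower_bound
  have hpr : 1 ≤ p.toReal := by
    rw [← ENNReal.toReal_one]; exact (ENNReal.toReal_le_toReal ENNReal.one_ne_top hp.ne).2 h1
  have hs : 0 ≤ 1 - 1 / p.toReal := by
    rw [sub_nonneg, div_le_one (by linarith)]; exact hpr
  set X : ℝ := X₀ + 1 + X₁ with hX
  set I : ℝ≥0∞ := ∫⁻ x in {x : ℝ | X₀ ≤ |x|}, ENNReal.ofReal (1 / φ x) with hIdef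
  set J : ℝ≥0∞ := ∫⁻ x in {x : ℝ | X ≤ |x|}, ENNReal.ofReal (B * |x| ^ (-1 - 1 / p.toReal)) with hJ
  have hJt : J ≠ ⊤ := by
    refine lintegral_abs_rpow_tail_ne_top ?_ (by linarith) B
    have : 0 < 1 / p.toReal := by positivity
    linarith
  set s : ℝ≥0∞ := ENNReal.ofReal (1 / c) + 1 with hsdef
  set C : ℝ≥0∞ := s * ENNReal.ofReal (2 * X) + (ENNReal.ofReal D * ENNReal.ofReal (2 * 1)
    + ENNReal.ofReal (2 * D) * I ^ (1 - 1 / p.toReal) + I * ENNReal.ofReal D + J * (s + 1)) with hC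
  have hCt : C ≠ ⊤ := by
    have hIp : I ^ (1 - 1 / p.toReal) ≠ ⊤ := ENNReal.rpow_ne_top_of_nonneg hs hI
    have hst : s ≠ ⊤ := by simp [hsdef]
    generalize I ^ (1 - 1 / p.toReal) = Q at hC hIp
    simp [hC, ENNReal.add_eq_top, ENNReal.mul_eq_top, hIp, hst, hI, hJt]
  refine ⟨C.toNNReal, fun g F hgl hg hF => ?_⟩
  rw [ENNReal.coe_toNNReal hCt]
  set W : ℝ≥0∞ := ∫⁻ y, ‖(φ y : ℂ) * F y‖ₑ with hW
  set E : ℝ≥0∞ := eLpNorm g p volume with hE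
  have hFc : Continuous F := continuous_of_primitive hgl hF
  have hφF : AEMeasurable (fun y => ‖(φ y : ℂ) * F y‖ₑ) volume :=
    ((Complex.measurable_ofReal.comp_aemeasurable hφ.aemeasurable).mul hFc.aemeasurable).enorm
  have hS : ∀ y, ‖F y‖ₑ ≤ s * (W + E) := by
    intro y
    refine (enorm_le_lintegral_add_eLpNorm h1 hp hg hF y).trans ?_
    have : ∫⁻ y, ‖F y‖ₑ ≤ ENNReal.ofReal (1 / c) * W := by
      rw [hW, ← lintegral_const_mul' _ _ ENNReal.ofReal_ne_top]
      refine lintegral_mono fun t => ?_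
      have hct : c ≤ φ t := by
        have := hlow t
        have := abs_nonneg t
        nlinarith
      rw [enorm_mul, ← mul_assoc, ← ofReal_norm (φ t : ℂ), Complex.norm_real, Real.norm_eq_abs,
        abs_of_pos (by linarith), ← ENNReal.ofReal_mul (by positivity)]
      refine le_mul_of_one_le_left' ?_
      rw [ENNReal.one_le_ofReal, one_div_mul_eq_div, le_div_iff₀ hc, one_mul]
      exact hct
    rw [hsdef, add_mul, one_mul, mul_add]
    calc _ ≤ ENNReal.ofReal (1 / c) * W + E := by gcongr
      _ ≤ _ := add_le_add le_self_add le_add_self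
  have hmX : MeasurableSet {x : ℝ | X ≤ |x|} :=
    measurableSet_le measurable_const continuous_abs.measurable
  have hmX₀ : MeasurableSet {x : ℝ | X₀ ≤ |x|} :=
    measurableSet_le measurable_const continuous_abs.measurable
  have hinv : AEMeasurable (fun y => 1 / φ y) volume := by
    simp only [one_div]
    exact hφ.aemeasurable.inv
  have hρ : AEMeasurable ({y : ℝ | X₀ ≤ |y|}.indicator fun y => D * (1 / φ y)) volume :=
    (hinv.const_mul D).indicator hmX₀
  have hG1 : AEMeasurable (fun y => ENNReal.ofReal D * ‖(φ y : ℂ) * F y‖ₑ) volume :=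
    hφF.const_mul _
  have hG2 : AEMeasurable (fun y => ‖g y‖ₑ) volume := hg.1.enorm
  set A₁ : ℝ → ℝ≥0∞ := fun x => ∫⁻ y, {z : ℝ × ℝ | |z.1 - z.2| ≤ (fun _ => 1) z.2}.indicator
        (fun z => ENNReal.ofReal D * ‖(φ z.2 : ℂ) * F z.2‖ₑ) (x, y) with hA₁
  set A₂ : ℝ → ℝ≥0∞ := fun x => ∫⁻ y, {z : ℝ × ℝ | |z.1 - z.2| ≤ {y : ℝ | X₀ ≤ |y|}.indicator
          (fun y => D * (1 / φ y)) z.2}.indicator (fun z => ‖g z.2‖ₑ) (x, y) with hA₂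
  have mA₁ : AEMeasurable A₁ volume :=
    (aemeasurable_uncurry_indicator_ball hG1 aemeasurable_const).lintegral_prod_right
  have mA₂ : AEMeasurable A₂ volume :=
    (aemeasurable_uncurry_indicator_ball hG2 hρ).lintegral_prod_right
  have iA₁ : ∫⁻ x, A₁ x = ENNReal.ofReal D * ENNReal.ofReal (2 * 1) * W := by
    rw [hA₁, lintegral_lintegral_indicator_ball (ρ := fun _ => 1) hG1 aemeasurable_const,
      lintegral_mul_const' _ _ ENNReal.ofReal_ne_top,
      lintegral_const_mul' _ _ ENNReal.ofReal_ne_top]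
    ring
  have iA₂ : ∫⁻ x, A₂ x ≤ ENNReal.ofReal (2 * D) * I ^ (1 - 1 / p.toReal) * E := by
    rw [hA₂, lintegral_lintegral_indicator_ball hG2 hρ]
    have hh := lintegral_enorm_mul_le_eLpNorm_mul h1 hp hg.1
      (w := {y : ℝ | X₀ ≤ |y|}.indicator fun y => ENNReal.ofReal (1 / φ y))
      (hinv.ennreal_ofReal.indicator hmX₀) (fun y => by
        by_cases hy : y ∈ {y : ℝ | X₀ ≤ |y|}
        · rw [Set.indicator_of_mem hy, ENNReal.ofReal_le_one]
          have := hone y hy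
          rw [div_le_one (by linarith)]; exact this
        · rw [Set.indicator_of_notMem hy]; exact zero_le)
    rw [lintegral_indicator hmX₀] at hh
    calc ∫⁻ y, ‖g y‖ₑ * ENNReal.ofReal
          (2 * {y : ℝ | X₀ ≤ |y|}.indicator (fun y => D * (1 / φ y)) y)
        = ENNReal.ofReal (2 * D) * ∫⁻ y, ‖g y‖ₑ *
            {y : ℝ | X₀ ≤ |y|}.indicator (fun y => ENNReal.ofReal (1 / φ y)) y := by
          rw [← lintegral_const_mul' _ _ ENNReal.ofReal_ne_top]
          refine lintegral_congr fun y => ?_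
          by_cases hy : y ∈ {y : ℝ | X₀ ≤ |y|}
          · rw [Set.indicator_of_mem hy, Set.indicator_of_mem hy, ← mul_assoc,
              ENNReal.ofReal_mul (by positivity)]
            ring
          · rw [Set.indicator_of_notMem hy, Set.indicator_of_notMem hy]
            simp
      _ ≤ ENNReal.ofReal (2 * D) * (E * I ^ (1 - 1 / p.toReal)) := by gcongr
      _ = _ := by ring
  rw [← lintegral_add_compl _ hmX.compl, compl_compl]
  have hvol : volume {x : ℝ | X ≤ |x|}ᶜ ≤ ENNReal.ofReal (2 * X) := by
    rw [← Real.volume_closedBall 0]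
    refine measure_mono fun x hx => ?_
    have hx' : ¬ X ≤ |x| := hx
    simpa using (not_le.1 hx').le
  have hsmall : ∫⁻ x in {x : ℝ | X ≤ |x|}ᶜ, oscMaximal γ F x
      ≤ s * ENNReal.ofReal (2 * X) * (W + E) := by
    calc ∫⁻ x in {x : ℝ | X ≤ |x|}ᶜ, oscMaximal γ F x
        ≤ ∫⁻ x in {x : ℝ | X ≤ |x|}ᶜ, s * (W + E) := by
          refine lintegral_mono fun x => iSup₂_le fun r hr => ?_
          exact average_le_of_enorm_le (e := fun t => Complex.exp (Complex.I * (γ x t : ℂ)))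
            (fun t => by rw [mul_comm]; exact Complex.norm_exp_ofReal_mul_I _) hr fun y _ => hS y
      _ = s * (W + E) * volume {x : ℝ | X ≤ |x|}ᶜ := setLIntegral_const _ _
      _ ≤ s * (W + E) * ENNReal.ofReal (2 * X) := by gcongr
      _ = _ := by ring
  have hlarge : ∫⁻ x in {x : ℝ | X ≤ |x|}, oscMaximal γ F x
      ≤ ENNReal.ofReal D * ENNReal.ofReal (2 * 1) * W
        + ENNReal.ofReal (2 * D) * I ^ (1 - 1 / p.toReal) * E
        + I * (ENNReal.ofReal D * W) + J * (s * (W + E) + E) := by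
    calc ∫⁻ x in {x : ℝ | X ≤ |x|}, oscMaximal γ F x
        ≤ ∫⁻ x in {x : ℝ | X ≤ |x|}, (A₁ x + A₂ x
            + ENNReal.ofReal (1 / φ x) * (ENNReal.ofReal D * W)
            + ENNReal.ofReal (B * |x| ^ (-1 - 1 / p.toReal)) * (s * (W + E) + E)) := by
          refine setLIntegral_mono_ae' hmX ?_
          filter_upwards [hdecay] with x hx hXx
          have hXx' : X ≤ |x| := hXx
          exact oscMaximal_le_of_large h1 hp hX₀ hD hcmp hone (hγ.continuous x) (by linarith)
            (hx (by linarith)) hgl hg hF hS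
      _ = (∫⁻ x in {x : ℝ | X ≤ |x|}, A₁ x) + (∫⁻ x in {x : ℝ | X ≤ |x|}, A₂ x)
            + (∫⁻ x in {x : ℝ | X ≤ |x|}, ENNReal.ofReal (1 / φ x) * (ENNReal.ofReal D * W))
            + ∫⁻ x in {x : ℝ | X ≤ |x|},
                ENNReal.ofReal (B * |x| ^ (-1 - 1 / p.toReal)) * (s * (W + E) + E) := by
          have m3 : AEMeasurable (fun x => ENNReal.ofReal (1 / φ x) * (ENNReal.ofReal D * W))
              volume := hinv.ennreal_ofReal.mul_const _
          have m12 : AEMeasurable (fun x => A₁ x + A₂ x) volume := mA₁.add mA₂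
          have m123 : AEMeasurable (fun x => A₁ x + A₂ x
              + ENNReal.ofReal (1 / φ x) * (ENNReal.ofReal D * W)) volume := m12.add m3
          rw [lintegral_add_left' m123.restrict, lintegral_add_left' m12.restrict,
            lintegral_add_left' mA₁.restrict]
      _ ≤ _ := by
          have m4 : Measurable fun x : ℝ =>
              ENNReal.ofReal (B * |x| ^ (-1 - 1 / p.toReal)) := by fun_prop
          rw [lintegral_mul_const'' _ hinv.ennreal_ofReal.restrict, lintegral_mul_const _ m4]
          have hsub : {x : ℝ | X ≤ |x|} ⊆ {x : ℝ | X₀ ≤ |x|} := fun x hx => by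
            have hx' : X ≤ |x| := hx
            show X₀ ≤ |x|
            linarith
          refine add_le_add (add_le_add (add_le_add ?_ ?_) ?_) le_rfl
          · exact (setLIntegral_le_lintegral _ _).trans iA₁.le
          · exact (setLIntegral_le_lintegral _ _).trans iA₂
          · exact mul_le_mul_left (lintegral_mono_set hsub) _
  refine (add_le_add hsmall hlarge).trans ?_
  have hWN : W ≤ W + E := le_self_add
  have hEN : E ≤ W + E := le_add_self
  calc _ ≤ s * ENNReal.ofReal (2 * X) * (W + E)
        + (ENNReal.ofReal D * ENNReal.ofReal (2 * 1) * (W + E)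
        + ENNReal.ofReal (2 * D) * I ^ (1 - 1 / p.toReal) * (W + E)
        + I * (ENNReal.ofReal D * (W + E)) + J * (s * (W + E) + (W + E))) := by gcongr
    _ = C * (W + E) := by rw [hC]; ring

/-! ### The logarithmic weights -/

theorem logWeight_of_one_le {m x : ℝ} (hx : 1 ≤ |x|) :
    logWeight m x = 1 + |x| * Real.log |x| ^ m := by
  simp [logWeight, Set.indicator, hx]

theorem logWeight_abs (m x : ℝ) : logWeight m |x| = logWeight m x := by
  simp [logWeight, Set.indicator]

theorem one_le_logWeight (m x : ℝ) : 1 ≤ logWeight m x := by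
  unfold logWeight
  have : 0 ≤ Set.indicator {y : ℝ | 1 ≤ |y|} (fun y => |y| * (Real.log |y|) ^ m) x :=
    Set.indicator_nonneg (fun y hy =>
      mul_nonneg (abs_nonneg _) (Real.rpow_nonneg (Real.log_nonneg hy) _)) x
  linarith

theorem monotoneOn_logWeight {m : ℝ} (hm : 0 ≤ m) : MonotoneOn (logWeight m) (Set.Ici 0) := by
  intro x hx y hy hxy
  have hx0 : 0 ≤ x := hx
  have hy0 : 0 ≤ y := hy
  rcases lt_or_ge x 1 with h | h
  · have : logWeight m x = 1 := by simp [logWeight, Set.indicator, abs_of_nonneg hx0, h]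
    rw [this]; exact one_le_logWeight m y
  · rw [logWeight_of_one_le (by rwa [abs_of_nonneg hx0]),
      logWeight_of_one_le (by rw [abs_of_nonneg hy0]; linarith), abs_of_nonneg hx0,
      abs_of_nonneg hy0]
    have := Real.log_nonneg h
    gcongr

/-- The antiderivative is `(log x) ^ (1 - m) / (1 - m)`, which tends to `0` because `m > 1`. -/
theorem integrableOn_inv_mul_log_rpow {m : ℝ} (hm : 1 < m) :
    IntegrableOn (fun x : ℝ => x⁻¹ * Real.log x ^ (-m)) (Set.Ioi (Real.exp 1)) := by
  have hlog : ∀ x ∈ Set.Ici (Real.exp 1), 1 ≤ Real.log x := fun x hx => by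
    rw [← Real.log_exp 1]; exact Real.log_le_log (Real.exp_pos _) hx
  refine integrableOn_Ioi_deriv_of_nonneg' (g := fun x => Real.log x ^ (1 - m) / (1 - m)) (l := 0)
    (fun x hx => ?_) (fun x hx => ?_) ?_
  · have hx0 : 0 < x := (Real.exp_pos 1).trans_le hx
    have hl := hlog x hx
    have h1m : 1 - m ≠ 0 := by linarith
    have := ((Real.hasDerivAt_log hx0.ne').rpow_const (p := 1 - m)
      (Or.inl (by linarith))).div_const (1 - m)
    convert! this using 1
    rw [show 1 - m - 1 = -m by ring]
    field_simp
  · have hx0 : 0 < x := (Real.exp_pos 1).trans hx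
    have hl := hlog x (Set.mem_Ici.2 (le_of_lt hx))
    have : 0 ≤ Real.log x := by linarith
    positivity
  · have h := (tendsto_rpow_neg_atTop (show 0 < m - 1 by linarith)).comp Real.tendsto_log_atTop
    have := h.div_const (1 - m)
    simpa [Function.comp_def] using this

theorem isAdmissibleWeight_logWeight {m : ℝ} (hm : 1 < m) :
    IsAdmissibleWeight (logWeight m) := by
  have hmeas : Measurable (logWeight m) := by
    unfold logWeight
    refine measurable_const.add (Measurable.indicator (by fun_prop) ?_)
    exact measurableSet_le measurable_const continuous_abs.measurable
  have hmono := monotoneOn_logWeight (show 0 ≤ m by linarith)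
  have he1 : 1 ≤ Real.exp 1 := Real.one_le_exp zero_le_one
  have hbig : ∀ t : ℝ, Real.exp 1 ≤ |t| → 1 ≤ Real.log |t| := fun t ht => by
    rw [← Real.log_exp 1]; exact Real.log_le_log (Real.exp_pos _) ht
  refine ⟨hmeas.aemeasurable, fun x => ?_, ⟨1 / (1 + Real.exp 1), by positivity, fun t => ?_⟩,
    ⟨0, hmono⟩, ⟨max (2 * 2 ^ m) (logWeight m 4), fun x => ?_⟩, ⟨Real.exp 1, Real.exp_pos 1, ?_⟩⟩
  · rw [← logWeight_abs, abs_neg, logWeight_abs]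
  · rw [one_div_mul_eq_div, div_le_iff₀ (by positivity)]
    have h1 := one_le_logWeight m t
    rcases le_total |t| (Real.exp 1) with h | h
    · nlinarith
    · have hl := hbig t h
      rw [logWeight_of_one_le (he1.trans h)] at h1 ⊢
      have : 1 ≤ Real.log |t| ^ m := Real.one_le_rpow hl (by linarith)
      have h2 : |t| ≤ |t| * Real.log |t| ^ m := le_mul_of_one_le_right (abs_nonneg t) this
      nlinarith
  · have h1 := one_le_logWeight m x
    rcases le_total |x| 2 with h | h
    · have h4 : logWeight m (2 * x) ≤ logWeight m 4 := by
        rw [← logWeight_abs]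
        refine hmono (Set.mem_Ici.2 (abs_nonneg _)) (Set.mem_Ici.2 (by norm_num)) ?_
        rw [abs_mul, abs_two]; linarith
      have h5 := one_le_logWeight m 4
      calc logWeight m (2 * x) ≤ logWeight m 4 * 1 := by rw [mul_one]; exact h4
        _ ≤ max (2 * 2 ^ m) (logWeight m 4) * logWeight m x :=
          mul_le_mul (le_max_right _ _) h1 zero_le_one (by positivity)
    · have hx1 : 1 ≤ |x| := by linarith
      have h2x : |2 * x| = 2 * |x| := by rw [abs_mul, abs_two]
      have hl0 : 0 ≤ Real.log |x| := Real.log_nonneg hx1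
      have hlog : Real.log (2 * |x|) ≤ 2 * Real.log |x| := by
        rw [Real.log_mul (by norm_num) (by linarith), two_mul]
        have := Real.log_le_log (by norm_num) h
        linarith
      have hl2 : 0 ≤ Real.log (2 * |x|) := Real.log_nonneg (by linarith)
      have hpow : Real.log (2 * |x|) ^ m ≤ 2 ^ m * Real.log |x| ^ m := by
        rw [← Real.mul_rpow (by norm_num) hl0]
        gcongr
      have h2m : 1 ≤ (2 : ℝ) ^ m := Real.one_le_rpow (by norm_num) (by linarith)
      have hle : logWeight m (2 * x) ≤ 2 * 2 ^ m * logWeight m x := by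
        rw [logWeight_of_one_le (by rw [h2x]; linarith), logWeight_of_one_le hx1, h2x]
        have : 2 * |x| * Real.log (2 * |x|) ^ m ≤ 2 * |x| * (2 ^ m * Real.log |x| ^ m) := by
          gcongr
        linarith
      exact hle.trans (mul_le_mul_of_nonneg_right (le_max_left _ _) (by linarith))
  · have hi := integrableOn_comp_abs (Real.exp_pos 1).le (integrableOn_inv_mul_log_rpow hm)
    refine Integrable.mono' hi (by
      simp only [one_div]
      exact hmeas.inv.aestronglyMeasurable) ?_
    refine (ae_restrict_iff' (measurableSet_lt measurable_const continuous_abs.measurable)).2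
      (Filter.Eventually.of_forall fun x hx => ?_)
    have hx' : Real.exp 1 < |x| := hx
    have hx0 : 0 < |x| := (Real.exp_pos 1).trans hx'
    have hl := hbig x hx'.le
    have hp : 0 < Real.log |x| ^ m := Real.rpow_pos_of_pos (by linarith) _
    have h1 := one_le_logWeight m x
    rw [Real.norm_of_nonneg (by positivity), Real.rpow_neg (by linarith), ← mul_inv, one_div]
    refine inv_anti₀ (by positivity) ?_
    rw [logWeight_of_one_le (he1.trans hx'.le)]
    linarith

/-! ### The estimate on the weighted space -/

theorem mainTheorem3 :
    (∀ (p : ℝ≥0∞) (γ : ℝ → ℝ → ℝ) (φ : ℝ → ℝ), 1 ≤ p → p < ⊤ →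
      (IsSumPhase γ ∨ IsQuadraticPhase γ ∨ IsMonomialPhase γ) →
      IsAdmissibleWeight φ →
      ∃ C : ℝ≥0, ∀ f f' : ℝ → ℂ, MemWeightedSpace p φ f f' →
        AEMeasurable (oscMaximal γ f) volume ∧
        ∫⁻ x, oscMaximal γ f x ≤ (C : ℝ≥0∞) * weightedNorm p φ f f') ∧
    (∀ m : ℝ, 1 < m → IsAdmissibleWeight (logWeight m)) := by
  refine ⟨fun p γ φ h1 hp hγ hφ => ?_, fun m hm => isAdmissibleWeight_logWeight hm⟩
  have hgood : IsGoodPhase γ := by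
    rcases hγ with h | h | h
    · exact h.isGoodPhase
    · exact h.isGoodPhase
    · exact h.isGoodPhase
  obtain ⟨C, hC⟩ := lintegral_oscMaximal_le h1 hp hgood hφ
  refine ⟨C, fun f f' hf => ?_⟩
  have hgl := hf.isWeakDeriv.locallyIntegrable_deriv
  obtain ⟨F, hfF, hF⟩ := hf.isWeakDeriv.exists_primitive
  have hosc : oscMaximal γ f = oscMaximal γ F := funext fun x => oscMaximal_congr_ae γ hfF x
  have hnorm : weightedNorm p φ f f'
      = (∫⁻ y, ‖(φ y : ℂ) * F y‖ₑ) + eLpNorm f' p volume := by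
    rw [weightedNorm, eLpNorm_one_eq_lintegral_enorm]
    congr 1
    refine lintegral_congr_ae ?_
    filter_upwards [hfF] with y hy
    rw [hy]
  rw [hosc, hnorm]
  exact ⟨aemeasurable_oscMaximal (continuous_of_primitive hgl hF) hgood.continuous
    hgood.aemeasurable, hC f' F hgl hf.memLp_deriv hF⟩
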